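/- Let $a<b$ be real, $q,n\ge 0$ integers, and $(s_k)$ a sequence of complex $q\times q$ matrices; write $I$ for identity matrices and ${}^*$ for the conjugate transpose, and $F^*(w):=(F(w))^*$ for a matrix function $F$. **Block matrices.** For $j\ge0$ put $\widetilde H_{r,j}=(s_{l+k+r})_{l,k=0}^{j}$ and $$H_{1,j}=\widetilde H_{0,j},\quad H_{2,j}=-ab\widetilde H_{0,j}+(a+b)\widetilde H_{1,j}-\widetilde H_{2,j},\quad K_{1,j}=b\widetilde H_{0,j}-\widetilde H_{1,j},\quad K_{2,j}=-a\widetilde H_{0,j}+\widetilde H_{1,j}.$$ The sequence $(s_k)_{k=0}^{2n}$ is called Hausdorff positive definite if $H_{1,n}$ and (when $n\ge1$) $H_{2,n-1}$ are positive definite; $(s_k)_{k=0}^{2n+1}$ is called so if $K_{1,n}$ and $K_{2,n}$ are positive definite. Let $T_j$ be the $(j+1)q\times(j+1)q$ matrix with blocks $I_q$ on the first block subdiagonal and zeros elsewhere, $R_j(z)=(I-zT_j)^{-1}$, $\widehat s_j=-abs_j+(a+b)s_{j+1}-s_{j+2}$, and define the block columns with $j+1$ blocks $$v_j=\begin{pmatrix}I_q\\0\\\vdots\\0\end{pmatrix},\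 u_{1,j}=\begin{pmatrix}0\\-s_0\\\vdots\\-s_{j-1}\end{pmatrix},\ u_{2,j}=\begin{pmatrix}-(a+b)s_0+s_1\\-\widehat s_0\\\vdots\\-\widehat s_{j-1}\end{pmatrix},\ \widetilde u_{1,j}=\begin{pmatrix}s_0\\s_1-bs_0\\\vdots\\s_j-bs_{j-1}\end{pmatrix},\ \widetilde u_{2,j}=\begin{pmatrix}-s_0\\-s_1+as_0\\\vdots\\-s_j+as_{j-1}\end{pmatrix}.$$ For $j\ge1$ let $Y_{1,j},Y_{2,j},\widetilde Y_{1,j},\widetilde Y_{2,j}$ be the block columns with the $j$ blocks $s_i$, $\widehat s_i$, $bs_i-s_{i+1}$, $-as_i+s_{i+1}$ ($j\le i\le 2j-1$), respectively. **Polynomials.** $P_{1,0}=P_{2,0}=\Gamma_{1,0}=\Gamma_{2,0}=I_q$, $Q_{1,0}=0$, $Q_{2,0}(z)=-(u_{2,0}+zs_0)$, $\Theta_{1,0}=s_0$, $\Theta_{2,0}=-s_0$, and for $j\ge1$, $k=1,2$, $$P_{k,j}(z)=(-Y_{k,j}^*H_{k,j-1}^{-1},I_q)R_j(z)v_j,\qquad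 Q_{1,j}(z)=-(-Y_{1,j}^*H_{1,j-1}^{-1},I_q)R_j(z)u_{1,j},$$ $$Q_{2,j}(z)=-(-Y_{2,j}^*H_{2,j-1}^{-1},I_q)R_j(z)(u_{2,j}+zv_js_0),$$ $$\Gamma_{k,j}(z)=(-\widetilde Y_{k,j}^*K_{k,j-1}^{-1},I_q)R_j(z)v_j,\qquad \Theta_{k,j}(z)=(-\widetilde Y_{k,j}^*K_{k,j-1}^{-1},I_q)R_j(z)\widetilde u_{k,j}.$$ **Dyukarev--Stieltjes matrix (DSM) parameters.** Put $$\lambda_j=(u_{2,j}^*+as_0v_j^*)R_j^*(a)H_{2,j}^{-1}R_j(a)(u_{2,j}+av_js_0),\qquad \mu_j=v_j^*R_j^*(a)K_{1,j}^{-1}R_j(a)v_j,$$ $$M'_j=v_j^*R_j^*(a)H_{1,j}^{-1}R_j(a)v_j,\qquad L'_j=\widetilde u_{2,j}^*R_j^*(a)K_{2,j}^{-1}R_j(a)\widetilde u_{2,j},$$ and $\mathbf l_0=\lambda_0$, $\mathbf m_0=\mu_0$, $\mathbf M_0=s_0^{-1}$, $\mathbf L_0=L'_0$, and for $j\ge1$: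 $\mathbf l_j=\lambda_j-\lambda_{j-1}$, $\mathbf m_j=\mu_j-\mu_{j-1}$, $\mathbf M_j=M'_j-M'_{j-1}$, $\mathbf L_j=L'_j-L'_{j-1}$. **Theorem.** Write $\frac AB=AB^{-1}$ for $B$ invertible, and let $z\in\mathbb C\setminus[a,b]$. (a) If $(s_k)_{k=0}^{2n}$ is Hausdorff positive definite, then the even Friedrichs and Krein extremal solutions are given by $$\frac{\Theta_{1,n}^*(\bar z)}{(b-z)\Gamma_{1,n}^*(\bar z)}=\frac{s_0}{b-z}+\cfrac{I_q}{-(z-a)(b-z)\mathbf m_0+\cfrac{I_q}{\frac1{b-z}\mathbf l_0+\cfrac{I_q}{\ddots\;-(z-a)(b-z)\mathbf m_{n-1}+\cfrac{I_q}{\frac1{b-z}\mathbf l_{n-1}}}}},$$ $$\frac{\Theta_{2,n}^*(\bar z)}{(z-a)\Gamma_{2,n}^*(\bar z)}=\cfrac{I_q}{-(z-a)\mathbf M_0+\cfrac{I_q}{\mathbf L_0+\cfrac{I_q}{\ddots\;+\mathbf L_{n-1}+\cfrac{I_q}{-(z-a)\mathbf M_n}}}}.$$ (b) If $(s_k)_{k=0}^{2n+1}$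 is Hausdorff positive definite, then the odd Friedrichs and Krein extremal solutions are given by $$-\frac{Q_{1,n+1}^*(\bar z)}{P_{1,n+1}^*(\bar z)}=\cfrac{I_q}{-(z-a)\mathbf M_0+\cfrac{I_q}{\mathbf L_0+\cfrac{I_q}{\ddots\;+\mathbf L_{n-1}+\cfrac{I_q}{-(z-a)\mathbf M_n+\mathbf L_n^{-1}}}}},$$ $$-\frac{Q_{2,n}^*(\bar z)}{(z-a)(b-z)P_{2,n}^*(\bar z)}=\frac{s_0}{b-z}+\cfrac{I_q}{-(z-a)(b-z)\mathbf m_0+\cfrac{I_q}{\frac1{b-z}\mathbf l_0+\cfrac{I_q}{\ddots\;\frac1{b-z}\mathbf l_{n-1}+\cfrac{I_q}{-(z-a)(b-z)\mathbf m_n}}}}.$$ In each of the four identities all denominators, on the left and at every level of the continued fraction on the right, are invertible. (For $n=0$ the first fraction is just $\frac{s_0}{b-z}$, the second $\frac{I_q}{-(z-a)\mathbf M_0}$, the third $\frac{I_q}{-(z-a)\mathbf M_0+\mathbf L_0^{-1}}$, and the fourth $\frac{s_0}{b-z}+\frac{I_q}{-(z-a)(b-z)\mathbf m_0}$.) -/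

import Mathlib

open scoped ComplexOrder Matrix

noncomputable section

namespace THMM

variable {q : ℕ}

/-- The complex `q × q` matrices. -/
abbrev Mat (q : ℕ) : Type := Matrix (Fin q) (Fin q) ℂ

/-- The complex `(j+1)q × (j+1)q` matrices, indexed by (block index, index inside the block). -/
abbrev BlockMat (q j : ℕ) : Type := Matrix (Fin (j + 1) × Fin q) (Fin (j + 1) × Fin q) ℂ

/-- Block columns of `j+1` blocks of size `q × q`. -/
abbrev BlockCol (q j : ℕ) : Type := Matrix (Fin (j + 1) × Fin q) (Fin q) ℂ

/-- Block rows of `j+1` blocks of size `q × q`. -/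
abbrev BlockRow (q j : ℕ) : Type := Matrix (Fin q) (Fin (j + 1) × Fin q) ℂ

/-- The block column with blocks `c 0, …, c j`. -/
def blockCol (c : ℕ → Mat q) (j : ℕ) : BlockCol q j :=
  Matrix.of fun i k => c i.1 i.2 k

/-- The block Hankel matrix `(s_{l+k+r})_{l,k=0}^j`. -/
def hankel (s : ℕ → Mat q) (r j : ℕ) : BlockMat q j :=
  Matrix.of fun l k => s (l.1 + k.1 + r) l.2 k.2

/-- `H_{1,j}`. -/
def H1 (s : ℕ → Mat q) (j : ℕ) : BlockMat q j := hankel s 0 j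

/-- `H_{2,j}`. -/
def H2 (a b : ℝ) (s : ℕ → Mat q) (j : ℕ) : BlockMat q j :=
  -((a : ℂ) * b) • hankel s 0 j + ((a : ℂ) + b) • hankel s 1 j - hankel s 2 j

/-- `K_{1,j}`. -/
def K1 (b : ℝ) (s : ℕ → Mat q) (j : ℕ) : BlockMat q j :=
  (b : ℂ) • hankel s 0 j - hankel s 1 j

/-- `K_{2,j}`. -/
def K2 (a : ℝ) (s : ℕ → Mat q) (j : ℕ) : BlockMat q j :=
  -(a : ℂ) • hankel s 0 j + hankel s 1 j

/-- `(s_k)_{k=0}^{2n}` is a Hausdorff positive definite sequence on `[a,b]`: `H_{1,n}` and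
`H_{2,n-1}` are positive definite (for `n = 0` the second condition is void). -/
def HausdorffPosDefEven (a b : ℝ) (s : ℕ → Mat q) (n : ℕ) : Prop :=
  (H1 s n).PosDef ∧ ∀ k, k + 1 = n → (H2 a b s k).PosDef

/-- `(s_k)_{k=0}^{2n+1}` is a Hausdorff positive definite sequence on `[a,b]`: `K_{1,n}` and
`K_{2,n}` are positive definite. -/
def HausdorffPosDefOdd (a b : ℝ) (s : ℕ → Mat q) (n : ℕ) : Prop :=
  (K1 b s n).PosDef ∧ (K2 a s n).PosDef

/-- The block shift `T_j`, with identity blocks on the first block subdiagonal. -/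
def T (q j : ℕ) : BlockMat q j :=
  Matrix.of fun i k => if (i.1 : ℕ) = k.1 + 1 ∧ i.2 = k.2 then 1 else 0

/-- `R_j(z) = (I - z T_j)⁻¹`. -/
def R (q j : ℕ) (z : ℂ) : BlockMat q j := (1 - z • T q j)⁻¹

/-- `v_j`, the block column `(I, 0, …, 0)`. -/
def v (q j : ℕ) : BlockCol q j := blockCol (fun i => if i = 0 then 1 else 0) j

/-- `ŝ_j`. -/
def sHat (a b : ℝ) (s : ℕ → Mat q) (j : ℕ) : Mat q :=
  -((a : ℂ) * b) • s j + ((a : ℂ) + b) • s (j + 1) - s (j + 2)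

/-- `u_{1,j}`, the block column `(0, -s_0, …, -s_{j-1})`. -/
def u1 (s : ℕ → Mat q) (j : ℕ) : BlockCol q j :=
  blockCol (fun i => match i with
    | 0 => 0
    | i + 1 => -s i) j

/-- `u_{2,j}`, the block column `(-(a+b)s_0 + s_1, -ŝ_0, …, -ŝ_{j-1})`. -/
def u2 (a b : ℝ) (s : ℕ → Mat q) (j : ℕ) : BlockCol q j :=
  blockCol (fun i => match i with
    | 0 => -((a : ℂ) + b) • s 0 + s 1
    | i + 1 => -sHat a b s i) j

/-- `ũ_{1,j}`, the block column `(s_0, s_1 - b s_0, …, s_j - b s_{j-1})`. -/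
def uTilde1 (b : ℝ) (s : ℕ → Mat q) (j : ℕ) : BlockCol q j :=
  blockCol (fun i => match i with
    | 0 => s 0
    | i + 1 => s (i + 1) - (b : ℂ) • s i) j

/-- `ũ_{2,j}`, the block column `(-s_0, -s_1 + a s_0, …, -s_j + a s_{j-1})`. -/
def uTilde2 (a : ℝ) (s : ℕ → Mat q) (j : ℕ) : BlockCol q j :=
  blockCol (fun i => match i with
    | 0 => -s 0
    | i + 1 => -s (i + 1) + (a : ℂ) • s i) j

/-- `Y_{1,j+1}`, the block column `(s_{j+1}, …, s_{2j+1})`. -/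
def Y1 (s : ℕ → Mat q) (j : ℕ) : BlockCol q j :=
  blockCol (fun i => s (j + 1 + i)) j

/-- `Y_{2,j+1}`, the block column `(ŝ_{j+1}, …, ŝ_{2j+1})`. -/
def Y2 (a b : ℝ) (s : ℕ → Mat q) (j : ℕ) : BlockCol q j :=
  blockCol (fun i => sHat a b s (j + 1 + i)) j

/-- `Ỹ_{1,j+1}`, the block column with blocks `b s_{j+1+i} - s_{j+2+i}`, `0 ≤ i ≤ j`. -/
def YTilde1 (b : ℝ) (s : ℕ → Mat q) (j : ℕ) : BlockCol q j :=
  blockCol (fun i => (b : ℂ) • s (j + 1 + i) - s (j + 2 + i)) j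

/-- `Ỹ_{2,j+1}`, the block column with blocks `-a s_{j+1+i} + s_{j+2+i}`, `0 ≤ i ≤ j`. -/
def YTilde2 (a : ℝ) (s : ℕ → Mat q) (j : ℕ) : BlockCol q j :=
  blockCol (fun i => -(a : ℂ) • s (j + 1 + i) + s (j + 2 + i)) j

/-- The block row `(A, I_q)`. -/
def appendId {j : ℕ} (A : BlockRow q j) : BlockRow q (j + 1) :=
  Matrix.of fun i p =>
    Fin.lastCases (motive := fun _ => ℂ) ((1 : Mat q) i p.2) (fun r => A i (r, p.2)) p.1

/-- `P_{1,j}`. -/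
def P1 (s : ℕ → Mat q) : ℕ → ℂ → Mat q
  | 0, _ => 1
  | j + 1, z => appendId (-((Y1 s j)ᴴ * (H1 s j)⁻¹)) * R q (j + 1) z * v q (j + 1)

/-- `Q_{1,j}`. -/
def Q1 (s : ℕ → Mat q) : ℕ → ℂ → Mat q
  | 0, _ => 0
  | j + 1, z => -(appendId (-((Y1 s j)ᴴ * (H1 s j)⁻¹)) * R q (j + 1) z * u1 s (j + 1))

/-- `P_{2,j}`. -/
def P2 (a b : ℝ) (s : ℕ → Mat q) : ℕ → ℂ → Mat q
  | 0, _ => 1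
  | j + 1, z => appendId (-((Y2 a b s j)ᴴ * (H2 a b s j)⁻¹)) * R q (j + 1) z * v q (j + 1)

/-- `Q_{2,j}`. -/
def Q2 (a b : ℝ) (s : ℕ → Mat q) : ℕ → ℂ → Mat q
  | 0, z => -((-((a : ℂ) + b) • s 0 + s 1) + z • s 0)
  | j + 1, z => -(appendId (-((Y2 a b s j)ᴴ * (H2 a b s j)⁻¹)) * R q (j + 1) z *
      (u2 a b s (j + 1) + z • (v q (j + 1) * s 0)))

/-- `Γ_{1,j}`. -/
def Gamma1 (b : ℝ) (s : ℕ → Mat q) : ℕ → ℂ → Mat q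
  | 0, _ => 1
  | j + 1, z => appendId (-((YTilde1 b s j)ᴴ * (K1 b s j)⁻¹)) * R q (j + 1) z * v q (j + 1)

/-- `Γ_{2,j}`. -/
def Gamma2 (a : ℝ) (s : ℕ → Mat q) : ℕ → ℂ → Mat q
  | 0, _ => 1
  | j + 1, z => appendId (-((YTilde2 a s j)ᴴ * (K2 a s j)⁻¹)) * R q (j + 1) z * v q (j + 1)

/-- `Θ_{1,j}`. -/
def Theta1 (b : ℝ) (s : ℕ → Mat q) : ℕ → ℂ → Mat q
  | 0, _ => s 0
  | j + 1, z =>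
      appendId (-((YTilde1 b s j)ᴴ * (K1 b s j)⁻¹)) * R q (j + 1) z * uTilde1 b s (j + 1)

/-- `Θ_{2,j}`. -/
def Theta2 (a : ℝ) (s : ℕ → Mat q) : ℕ → ℂ → Mat q
  | 0, _ => -s 0
  | j + 1, z =>
      appendId (-((YTilde2 a s j)ᴴ * (K2 a s j)⁻¹)) * R q (j + 1) z * uTilde2 a s (j + 1)

/-- `(u*_{2,j} + a s_0 v_j*) R_j*(a) H_{2,j}⁻¹ R_j(a) (u_{2,j} + a v_j s_0)`. -/
def lSum (a b : ℝ) (s : ℕ → Mat q) (j : ℕ) : Mat q :=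
  ((u2 a b s j)ᴴ + (a : ℂ) • (s 0 * (v q j)ᴴ)) * (R q j a)ᴴ * (H2 a b s j)⁻¹ * R q j a *
    (u2 a b s j + (a : ℂ) • (v q j * s 0))

/-- The parameters `𝐥_j`, `j ≥ 0`. -/
def l (a b : ℝ) (s : ℕ → Mat q) : ℕ → Mat q
  | 0 => lSum a b s 0
  | j + 1 => lSum a b s (j + 1) - lSum a b s j

/-- `v_j* R_j*(a) K_{1,j}⁻¹ R_j(a) v_j`. -/
def mSum (a b : ℝ) (s : ℕ → Mat q) (j : ℕ) : Mat q :=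
  (v q j)ᴴ * (R q j a)ᴴ * (K1 b s j)⁻¹ * R q j a * v q j

/-- The parameters `𝐦_j`, `j ≥ 0`. -/
def m (a b : ℝ) (s : ℕ → Mat q) : ℕ → Mat q
  | 0 => mSum a b s 0
  | j + 1 => mSum a b s (j + 1) - mSum a b s j

/-- `v_j* R_j*(a) H_{1,j}⁻¹ R_j(a) v_j`. -/
def MSum (a : ℝ) (s : ℕ → Mat q) (j : ℕ) : Mat q :=
  (v q j)ᴴ * (R q j a)ᴴ * (H1 s j)⁻¹ * R q j a * v q j

/-- The parameters `𝐌_j`, `j ≥ 0`. -/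
def M (a : ℝ) (s : ℕ → Mat q) : ℕ → Mat q
  | 0 => (s 0)⁻¹
  | j + 1 => MSum a s (j + 1) - MSum a s j

/-- `ũ*_{2,j} R_j*(a) K_{2,j}⁻¹ R_j(a) ũ_{2,j}`. -/
def LSum (a : ℝ) (s : ℕ → Mat q) (j : ℕ) : Mat q :=
  (uTilde2 a s j)ᴴ * (R q j a)ᴴ * (K2 a s j)⁻¹ * R q j a * uTilde2 a s j

/-- The parameters `𝐋_j`, `j ≥ 0`. -/
def L (a : ℝ) (s : ℕ → Mat q) : ℕ → Mat q
  | 0 => LSum a s 0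
  | j + 1 => LSum a s (j + 1) - LSum a s j

/-- The denominator `(b - z) Γ*_{1,n}(z̄)` of the even Friedrichs extremal solution. -/
def denFriedrichsEven (b : ℝ) (s : ℕ → Mat q) (n : ℕ) (z : ℂ) : Mat q :=
  ((b : ℂ) - z) • (Gamma1 b s n (star z))ᴴ

/-- The even Friedrichs extremal solution `Θ*_{1,n}(z̄) / ((b - z) Γ*_{1,n}(z̄))`. -/
def friedrichsEven (b : ℝ) (s : ℕ → Mat q) (n : ℕ) (z : ℂ) : Mat q :=
  (Theta1 b s n (star z))ᴴ * (denFriedrichsEven b s n z)⁻¹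

/-- The denominator `(z - a) Γ*_{2,n}(z̄)` of the even Krein extremal solution. -/
def denKreinEven (a : ℝ) (s : ℕ → Mat q) (n : ℕ) (z : ℂ) : Mat q :=
  (z - (a : ℂ)) • (Gamma2 a s n (star z))ᴴ

/-- The even Krein extremal solution `Θ*_{2,n}(z̄) / ((z - a) Γ*_{2,n}(z̄))`. -/
def kreinEven (a : ℝ) (s : ℕ → Mat q) (n : ℕ) (z : ℂ) : Mat q :=
  (Theta2 a s n (star z))ᴴ * (denKreinEven a s n z)⁻¹

/-- The denominator `P*_{1,n+1}(z̄)` of the odd Friedrichs extremal solution. -/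
def denFriedrichsOdd (s : ℕ → Mat q) (n : ℕ) (z : ℂ) : Mat q :=
  (P1 s (n + 1) (star z))ᴴ

/-- The odd Friedrichs extremal solution `-Q*_{1,n+1}(z̄) / P*_{1,n+1}(z̄)`. -/
def friedrichsOdd (s : ℕ → Mat q) (n : ℕ) (z : ℂ) : Mat q :=
  -((Q1 s (n + 1) (star z))ᴴ * (denFriedrichsOdd s n z)⁻¹)

/-- The denominator `(z - a)(b - z) P*_{2,n}(z̄)` of the odd Krein extremal solution. -/
def denKreinOdd (a b : ℝ) (s : ℕ → Mat q) (n : ℕ) (z : ℂ) : Mat q :=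
  ((z - (a : ℂ)) * ((b : ℂ) - z)) • (P2 a b s n (star z))ᴴ

/-- The odd Krein extremal solution `-Q*_{2,n}(z̄) / ((z - a)(b - z) P*_{2,n}(z̄))`. -/
def kreinOdd (a b : ℝ) (s : ℕ → Mat q) (n : ℕ) (z : ℂ) : Mat q :=
  -((Q2 a b s n (star z))ᴴ * (denKreinOdd a b s n z)⁻¹)

/-- The finite matrix continued fraction `c₀ + I/(c₁ + I/(c₂ + ⋯ + I/c_k))` of the nonempty
list `[c₀, …, c_k]`. -/
def contFrac : List (Mat q) → Mat q
  | [] => 0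
  | [c] => c
  | c :: d :: t => c + (contFrac (d :: t))⁻¹

/-- Every denominator that occurs in the continued fraction of the list is invertible. -/
def ContFracDefined : List (Mat q) → Prop
  | [] => True
  | [_] => True
  | _ :: d :: t => IsUnit (contFrac (d :: t)) ∧ ContFracDefined (d :: t)

/-- `-(z-a)(b-z)𝐦_0, (b-z)⁻¹𝐥_0, …, -(z-a)(b-z)𝐦_{n-1}, (b-z)⁻¹𝐥_{n-1}`. -/
def mlList (a b : ℝ) (s : ℕ → Mat q) (z : ℂ) (n : ℕ) : List (Mat q) :=
  (List.range n).flatMap fun j =>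
    [-((z - (a : ℂ)) * ((b : ℂ) - z)) • m a b s j, ((b : ℂ) - z)⁻¹ • l a b s j]

/-- `-(z-a)𝐌_0, 𝐋_0, …, -(z-a)𝐌_{n-1}, 𝐋_{n-1}`. -/
def MLList (a : ℝ) (s : ℕ → Mat q) (z : ℂ) (n : ℕ) : List (Mat q) :=
  (List.range n).flatMap fun j => [-(z - (a : ℂ)) • M a s j, L a s j]

/-- The terms of the continued fraction of the even Friedrichs extremal solution. -/
def termsFriedrichsEven (a b : ℝ) (s : ℕ → Mat q) (n : ℕ) (z : ℂ) : List (Mat q) :=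
  ((b : ℂ) - z)⁻¹ • s 0 :: mlList a b s z n

/-- The terms of the continued fraction of the even Krein extremal solution. -/
def termsKreinEven (a : ℝ) (s : ℕ → Mat q) (n : ℕ) (z : ℂ) : List (Mat q) :=
  0 :: (MLList a s z n ++ [-(z - (a : ℂ)) • M a s n])

/-- The terms of the continued fraction of the odd Friedrichs extremal solution. -/
def termsFriedrichsOdd (a : ℝ) (s : ℕ → Mat q) (n : ℕ) (z : ℂ) : List (Mat q) :=
  0 :: (MLList a s z n ++ [-(z - (a : ℂ)) • M a s n, L a s n])

/-- The terms of the continued fraction of the odd Krein extremal solution. -/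
def termsKreinOdd (a b : ℝ) (s : ℕ → Mat q) (n : ℕ) (z : ℂ) : List (Mat q) :=
  ((b : ℂ) - z)⁻¹ • s 0 ::
    (mlList a b s z n ++ [-((z - (a : ℂ)) * ((b : ℂ) - z)) • m a b s n])

end THMM

end

/-! ### Matrix polynomials with left coefficients -/

open scoped Polynomial

noncomputable section

namespace THMM

variable {q : ℕ}

/-! Read s_k formally as ∫ tᵏ dσ and let ⟨p, r⟩ = ∑ p_i s_{i+k} r_k* on polynomials with matrix
coefficients on the left. Then `sh a s` and `bs b s` belong to (t-a)σ and (b-t)σ, block Hankel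
equations become moment conditions, and the Hausdorff conditions become positivity of forms in
bounded degree.

Two families carry the proof: p_j (`normOrth`), orthogonal to lower degrees with p_j(a) = I, and g_j
(`reproPoly`), with ⟨g_j, tᵏ⟩ = aᵏ for k ≤ j and hence orthogonal to lower degrees for (t-a)σ.
Uniqueness of such polynomials shows that the DSM parameters link them: p_{j+1} = p_j - L_j (t-a)
g_j and g_{j+1} = g_j + M_{j+1} p_{j+1} (`normOrth_succ`, `reproPoly_succ`).

The remainder B(w)W - U(B)(w) of B would be ∫ B(t)/(t-w) dσ if W were ∫ dσ/(t-w). At w = z̄ the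
adjoint remainders ρ_j of p_j and τ_{j+1} of -(t-a)g_j obey two-term recurrences, which are the
steps of a continued fraction. With W = P(w)⁻¹U(P)(w), the remainder of P is zero, so the fraction
stops and gives ρ_0 = W*. Taking P = p_{n+1} gives the odd Friedrichs solution, P = (t-a)g_n the
even Krein one.

The levels of the fraction are quotients of remainders, so these must be invertible off [a,b]. If Y
annihilates the remainder of B, then YB - ZP = (t-w)e with ⟨e, 1⟩ = 0. Orthogonality and positivity
then force w = a + ε/β with 0 ≤ ε ≤ (b-a)β unless the relevant polynomial is zero, and then Y = 0.

The other two identities are these two for (b-t)σ: since (b-t)/(t-z) = (b-z)/(t-z) - 1, passing back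
to σ produces s_0/(b-z) and scales the terms alternately by b-z and its inverse. -/

/-- The left linear functional `∑ Aᵢ tⁱ ↦ ∑ Aᵢ cᵢ` on matrix polynomials. -/
def ev (c : ℕ → Mat q) : (Mat q)[X] →ₗ[Mat q] Mat q :=
  Polynomial.lsum fun i => LinearMap.toSpanSingleton (Mat q) (Mat q) (c i)

/-- All coefficients of `p` of index at least `n` vanish. -/
def DegLT (n : ℕ) (p : (Mat q)[X]) : Prop := ∀ i, n ≤ i → p.coeff i = 0

theorem DegLT.mono {m n : ℕ} {p : (Mat q)[X]} (hp : DegLT m p) (h : m ≤ n) : DegLT n p :=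
  fun i hi => hp i (h.trans hi)

theorem DegLT.add {n : ℕ} {p r : (Mat q)[X]} (hp : DegLT n p) (hr : DegLT n r) :
    DegLT n (p + r) := fun i hi => by simp [hp i hi, hr i hi]

theorem DegLT.sub {n : ℕ} {p r : (Mat q)[X]} (hp : DegLT n p) (hr : DegLT n r) :
    DegLT n (p - r) := fun i hi => by simp [hp i hi, hr i hi]

theorem DegLT.smul {n : ℕ} {p : (Mat q)[X]} (hp : DegLT n p) (A : Mat q) :
    DegLT n (A • p) := fun i hi => by simp [hp i hi]

theorem DegLT.X_mul {n : ℕ} {p : (Mat q)[X]} (hp : DegLT n p) :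
    DegLT (n + 1) (Polynomial.X * p) := by
  intro i hi
  obtain ⟨k, rfl⟩ : ∃ k, i = k + 1 := ⟨i - 1, by omega⟩
  rw [Polynomial.coeff_X_mul]
  exact hp k (by omega)

theorem DegLT.C (A : Mat q) : DegLT 1 (Polynomial.C A) := fun i hi => by
  rw [Polynomial.coeff_C, if_neg (by omega)]

theorem degLT_zero {p : (Mat q)[X]} (hp : DegLT 0 p) : p = 0 :=
  Polynomial.ext fun i => by simpa using hp i (Nat.zero_le i)

theorem DegLT.one : DegLT 1 (1 : (Mat q)[X]) := DegLT.C 1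

theorem exists_degLT (p : (Mat q)[X]) : ∃ n, DegLT n p :=
  ⟨p.natDegree + 1, fun _ hi => Polynomial.coeff_eq_zero_of_natDegree_lt (by omega)⟩

theorem ev_eq_sum (c : ℕ → Mat q) {n : ℕ} {p : (Mat q)[X]} (hp : DegLT n p) :
    ev c p = ∑ i ∈ Finset.range n, p.coeff i * c i := by
  simp only [ev, Polynomial.lsum_apply, LinearMap.toSpanSingleton_apply, smul_eq_mul]
  rw [Polynomial.sum_def]
  refine Finset.sum_subset ?_ ?_
  · intro i hi
    rw [Finset.mem_range]
    by_contra h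
    exact (Polynomial.mem_support_iff.1 hi) (hp i (by omega))
  · intro i _ hi
    rw [Polynomial.notMem_support_iff.1 hi, zero_mul]

theorem ev_smul (c : ℕ → Mat q) (A : Mat q) (p : (Mat q)[X]) : ev c (A • p) = A * ev c p := by
  rw [map_smul, smul_eq_mul]

theorem ev_C (c : ℕ → Mat q) (A : Mat q) : ev c (Polynomial.C A) = A * c 0 := by
  rw [ev_eq_sum c (DegLT.C A)]; simp

theorem ev_one (c : ℕ → Mat q) : ev c 1 = c 0 := by
  have := ev_C c 1
  rwa [map_one, one_mul] at this

theorem ev_sub_left (c d : ℕ → Mat q) (p : (Mat q)[X]) :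
    ev (fun i => c i - d i) p = ev c p - ev d p := by
  obtain ⟨n, hn⟩ := exists_degLT p
  simp [ev_eq_sum _ hn, mul_sub, Finset.sum_sub_distrib]

theorem ev_smul_left (c : ℕ → Mat q) (z : ℂ) (p : (Mat q)[X]) :
    ev (fun i => z • c i) p = z • ev c p := by
  obtain ⟨n, hn⟩ := exists_degLT p
  simp [ev_eq_sum _ hn, Finset.smul_sum]

theorem smul_one_smul_poly (z : ℂ) (p : (Mat q)[X]) : (z • (1 : Mat q)) • p = z • p := by
  rw [smul_assoc, one_smul]

theorem ev_csmul (c : ℕ → Mat q) (z : ℂ) (p : (Mat q)[X]) : ev c (z • p) = z • ev c p := by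
  rw [← smul_one_smul_poly, ev_smul]; simp

theorem ev_X_mul (c : ℕ → Mat q) (p : (Mat q)[X]) :
    ev c (Polynomial.X * p) = ev (fun i => c (i + 1)) p := by
  obtain ⟨n, hn⟩ := exists_degLT p
  rw [ev_eq_sum _ hn, ev_eq_sum _ hn.X_mul, Finset.sum_range_succ']
  simp [Polynomial.coeff_X_mul]

/-! ### Multiplication and division by `t - z` -/

/-- The product of `t - z` and the polynomial `p`. -/
def xsub (z : ℂ) (p : (Mat q)[X]) : (Mat q)[X] := Polynomial.X * p - z • p

theorem DegLT.csmul {n : ℕ} {p : (Mat q)[X]} (hp : DegLT n p) (z : ℂ) :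
    DegLT n (z • p) := fun i hi => by simp [hp i hi]

theorem DegLT.xsub {n : ℕ} {p : (Mat q)[X]} (hp : DegLT n p) (z : ℂ) :
    DegLT (n + 1) (xsub z p) :=
  hp.X_mul.sub ((hp.csmul z).mono (Nat.le_succ n))

theorem ev_xsub (c : ℕ → Mat q) (z : ℂ) (p : (Mat q)[X]) :
    ev c (xsub z p) = ev (fun i => c (i + 1)) p - z • ev c p := by
  rw [xsub, map_sub, ev_X_mul, ev_csmul]

theorem xsub_add (z : ℂ) (p r : (Mat q)[X]) : xsub z (p + r) = xsub z p + xsub z r := by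
  simp only [xsub, mul_add, smul_add]; abel

theorem xsub_smul (z : ℂ) (A : Mat q) (p : (Mat q)[X]) : xsub z (A • p) = A • xsub z p := by
  have h : Polynomial.X * A • p = A • (Polynomial.X * p) := by
    rw [Polynomial.smul_eq_C_mul, Polynomial.smul_eq_C_mul, Polynomial.X_mul, mul_assoc,
      Polynomial.X_mul]
  simp only [xsub, smul_sub, smul_comm z A, h]

theorem xsub_zero (z : ℂ) : xsub z (0 : (Mat q)[X]) = 0 := by simp [xsub]

theorem eq_zero_of_xsub_eq_zero {z : ℂ} {p : (Mat q)[X]} (h : xsub z p = 0) : p = 0 := by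
  have h' := congrArg (fun f => f.coeff (p.natDegree + 1)) h
  simp only [xsub, Polynomial.coeff_sub, Polynomial.coeff_X_mul, Polynomial.coeff_smul,
    Polynomial.coeff_zero, Polynomial.coeff_natDegree,
    Polynomial.coeff_eq_zero_of_natDegree_lt (Nat.lt_succ_self _), smul_zero, sub_zero] at h'
  exact Polynomial.leadingCoeff_eq_zero.1 h'

theorem xsub_comm (z w : ℂ) (p : (Mat q)[X]) : xsub z (xsub w p) = xsub w (xsub z p) := by
  simp only [xsub, mul_sub, smul_sub, mul_smul_comm, smul_comm z w]; abel

/-- The column of powers of `z`. -/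
def pt (q : ℕ) (z : ℂ) (i : ℕ) : Mat q := z ^ i • 1

theorem ev_pt_xsub (w z : ℂ) (p : (Mat q)[X]) :
    ev (pt q w) (xsub z p) = (w - z) • ev (pt q w) p := by
  rw [ev_xsub, sub_smul, ← ev_smul_left _ w]
  simp only [pt, smul_smul, pow_succ']

/-- Remainder theorem by Horner's scheme. The drop in degree matters: it brings the quotient into
the range where orthogonality and positivity are available. -/
theorem exists_xsub (z : ℂ) {n : ℕ} (f : (Mat q)[X]) (hf : DegLT (n + 1) f) :
    ∃ e, DegLT n e ∧ f = xsub z e + Polynomial.C (ev (pt q z) f) := by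
  induction n generalizing f with
  | zero =>
    refine ⟨0, fun _ _ => by simp, ?_⟩
    have : f = Polynomial.C (f.coeff 0) := by
      ext1 i
      rcases i with _ | i
      · simp
      · rw [hf _ (by omega), Polynomial.coeff_C_succ]
    rw [xsub_zero, zero_add, ev_eq_sum _ hf]
    simpa [pt] using this
  | succ n ih =>
    have hdiv : f = Polynomial.X * f.divX + Polynomial.C (f.coeff 0) := by
      rw [Polynomial.X_mul]; exact (Polynomial.divX_mul_X_add f).symm
    have hd : DegLT (n + 1) f.divX := fun i hi => by
      rw [Polynomial.coeff_divX]; exact hf _ (by omega)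
    obtain ⟨e, he, hfe⟩ := ih f.divX hd
    set B := ev (pt q z) f.divX with hB
    have hev : ev (pt q z) f = z • B + f.coeff 0 := by
      conv_lhs => rw [hdiv]
      rw [map_add, ev_X_mul, ev_C, hB, ← ev_smul_left]
      simp [pt, smul_smul, pow_succ']
    refine ⟨Polynomial.X * e + Polynomial.C B, he.X_mul.add ((DegLT.C B).mono (by omega)), ?_⟩
    rw [hev]
    conv_lhs => rw [hdiv, hfe]
    simp only [xsub, mul_add, mul_sub, smul_add, mul_smul_comm, map_add, ← Polynomial.smul_C]
    abel

theorem exists_eq_xsub {z : ℂ} {n : ℕ} {f : (Mat q)[X]} (hf : DegLT (n + 1) f)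
    (h : ev (pt q z) f = 0) : ∃ e, DegLT n e ∧ f = xsub z e := by
  obtain ⟨e, he, hfe⟩ := exists_xsub z f hf
  exact ⟨e, he, by rw [hfe, h]; simp⟩

/-! ### Moments and sesquilinear forms -/

/-- The sequence of moments of `(t - a) σ`, if `s` is that of `σ`. -/
def sh (a : ℝ) (s : ℕ → Mat q) (k : ℕ) : Mat q := s (k + 1) - (a : ℂ) • s k

/-- The sequence of moments of `(b - t) σ`, if `s` is that of `σ`. -/
def bs (b : ℝ) (s : ℕ → Mat q) (k : ℕ) : Mat q := (b : ℂ) • s k - s (k + 1)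

/-- The moment `⟨p, tᵏ⟩` of the polynomial `p`. -/
def S (s : ℕ → Mat q) (k : ℕ) : (Mat q)[X] →ₗ[Mat q] Mat q := ev fun i => s (i + k)

theorem S_smul (s : ℕ → Mat q) (k : ℕ) (A : Mat q) (p : (Mat q)[X]) :
    S s k (A • p) = A * S s k p := ev_smul _ _ _

theorem S_xsub (s : ℕ → Mat q) (k : ℕ) (z : ℂ) (p : (Mat q)[X]) :
    S s k (xsub z p) = S s (k + 1) p - z • S s k p := by
  simp only [S, ev_xsub, Nat.add_right_comm _ 1 k, Nat.add_assoc]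

theorem S_one (s : ℕ → Mat q) (k : ℕ) : S s k 1 = s k := by simp [S, ev_one]

theorem S_sh (a : ℝ) (s : ℕ → Mat q) (k : ℕ) (p : (Mat q)[X]) :
    S (sh a s) k p = S s k (xsub a p) := by
  rw [S_xsub]
  simp only [S, sh, ← ev_smul_left, ← ev_sub_left, Nat.add_assoc]

theorem S_sh' (a : ℝ) (s : ℕ → Mat q) (k : ℕ) (p : (Mat q)[X]) :
    S (sh a s) k p = S s (k + 1) p - (a : ℂ) • S s k p := by
  rw [S_sh, S_xsub]

theorem S_bs (b : ℝ) (s : ℕ → Mat q) (k : ℕ) (p : (Mat q)[X]) :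
    S (bs b s) k p = -S s k (xsub b p) := by
  rw [S_xsub, neg_sub]
  simp only [S, bs, ← ev_smul_left, ← ev_sub_left, Nat.add_assoc]

/-- The sesquilinear form `⟨p, r⟩ = ∑ pᵢ s_{i+k} rₖ*`. -/
def E (s : ℕ → Mat q) (p r : (Mat q)[X]) : Mat q :=
  ∑ k ∈ Finset.range (r.natDegree + 1), S s k p * (r.coeff k)ᴴ

theorem E_eq_sum (s : ℕ → Mat q) (p : (Mat q)[X]) {n : ℕ} {r : (Mat q)[X]} (hr : DegLT n r) :
    E s p r = ∑ k ∈ Finset.range n, S s k p * (r.coeff k)ᴴ := by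
  have key : ∀ m, DegLT m r → ∀ N, m ≤ N → ∑ k ∈ Finset.range m, S s k p * (r.coeff k)ᴴ =
      ∑ k ∈ Finset.range N, S s k p * (r.coeff k)ᴴ := by
    intro m hm N hN
    refine Finset.sum_subset (Finset.range_mono hN) fun i _ hi => ?_
    rw [hm i (by simpa using hi)]; simp
  have h1 : DegLT (r.natDegree + 1) r := fun _ hi =>
    Polynomial.coeff_eq_zero_of_natDegree_lt (by omega)
  rw [E, key _ h1 _ (le_max_left _ n), key _ hr _ (le_max_right (r.natDegree + 1) n)]

theorem E_add_left (s : ℕ → Mat q) (p p' r : (Mat q)[X]) : E s (p + p') r = E s p r + E s p' r := by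
  simp [E, add_mul, Finset.sum_add_distrib]

theorem E_sub_left (s : ℕ → Mat q) (p p' r : (Mat q)[X]) : E s (p - p') r = E s p r - E s p' r := by
  simp [E, sub_mul, Finset.sum_sub_distrib]

theorem E_smul_left (s : ℕ → Mat q) (A : Mat q) (p r : (Mat q)[X]) :
    E s (A • p) r = A * E s p r := by
  simp [E, Finset.mul_sum, mul_assoc]

theorem E_csmul_left (s : ℕ → Mat q) (z : ℂ) (p r : (Mat q)[X]) :
    E s (z • p) r = z • E s p r := by
  rw [← smul_one_smul_poly, E_smul_left]; simp

theorem E_add_right (s : ℕ → Mat q) (p r r' : (Mat q)[X]) :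
    E s p (r + r') = E s p r + E s p r' := by
  obtain ⟨n, hn⟩ := exists_degLT r
  obtain ⟨m, hm⟩ := exists_degLT r'
  have h1 := hn.mono (le_max_left n m)
  have h2 := hm.mono (le_max_right n m)
  simp [E_eq_sum s p h1, E_eq_sum s p h2, E_eq_sum s p (h1.add h2), mul_add,
    Finset.sum_add_distrib]

theorem E_smul_right (s : ℕ → Mat q) (A : Mat q) (p r : (Mat q)[X]) :
    E s p (A • r) = E s p r * Aᴴ := by
  obtain ⟨n, hn⟩ := exists_degLT r
  simp [E_eq_sum s p hn, E_eq_sum s p (hn.smul A), Finset.sum_mul, mul_assoc]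

theorem E_sub_right (s : ℕ → Mat q) (p r r' : (Mat q)[X]) :
    E s p (r - r') = E s p r - E s p r' := by
  rw [eq_sub_iff_add_eq, ← E_add_right, sub_add_cancel]

theorem E_csmul_right (s : ℕ → Mat q) (z : ℂ) (p r : (Mat q)[X]) :
    E s p (z • r) = star z • E s p r := by
  rw [← smul_one_smul_poly, E_smul_right]; simp

theorem E_eq_zero (s : ℕ → Mat q) {p r : (Mat q)[X]} {n : ℕ} (hr : DegLT n r)
    (h : ∀ k < n, S s k p = 0) : E s p r = 0 := by
  rw [E_eq_sum s p hr]
  exact Finset.sum_eq_zero fun k hk => by rw [h k (Finset.mem_range.1 hk), zero_mul]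

theorem E_X_mul (s : ℕ → Mat q) (p r : (Mat q)[X]) :
    E s (Polynomial.X * p) r = E s p (Polynomial.X * r) := by
  obtain ⟨n, hn⟩ := exists_degLT r
  rw [E_eq_sum _ _ hn, E_eq_sum _ _ hn.X_mul, Finset.sum_range_succ']
  simp only [Polynomial.coeff_X_mul, Polynomial.coeff_X_mul_zero, Matrix.conjTranspose_zero,
    mul_zero, add_zero, S, ev_X_mul, Nat.add_right_comm _ 1, Nat.add_assoc]

theorem E_xsub (s : ℕ → Mat q) (a : ℝ) (p r : (Mat q)[X]) :
    E s (xsub a p) r = E s p (xsub a r) := by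
  simp only [xsub, E_sub_left, E_sub_right, E_X_mul, E_csmul_left, E_csmul_right]
  simp

theorem E_sh (a : ℝ) (s : ℕ → Mat q) (p r : (Mat q)[X]) : E (sh a s) p r = E s (xsub a p) r := by
  simp [E, S_sh]

theorem E_bs (b : ℝ) (s : ℕ → Mat q) (p r : (Mat q)[X]) :
    E (bs b s) p r = -E s (xsub b p) r := by
  simp [E, S_bs]

theorem xsub_eq_add (z w : ℂ) (p : (Mat q)[X]) : xsub z p = xsub w p + (w - z) • p := by
  simp only [xsub, sub_smul]; abel

theorem E_xsub_left (a : ℝ) (s : ℕ → Mat q) (z : ℂ) (p r : (Mat q)[X]) :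
    E s (xsub z p) r = E (sh a s) p r - (z - a) • E s p r := by
  rw [xsub_eq_add z a, E_add_left, E_csmul_left, E_sh, ← neg_sub z, neg_smul, ← sub_eq_add_neg]

/-- The matrices `s k`, `k < N`, are Hermitian. -/
def Herm (s : ℕ → Mat q) (N : ℕ) : Prop := ∀ k < N, (s k)ᴴ = s k

theorem Herm.sh {s : ℕ → Mat q} {N : ℕ} (h : Herm s (N + 1)) (a : ℝ) : Herm (sh a s) N := by
  intro k hk
  simp [THMM.sh, h k (by omega), h (k + 1) (by omega)]

theorem Herm.bs {s : ℕ → Mat q} {N : ℕ} (h : Herm s (N + 1)) (b : ℝ) : Herm (bs b s) N := by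
  intro k hk
  simp [THMM.bs, h k (by omega), h (k + 1) (by omega)]

/-- Only moments of index at most `m + n - 2` occur, so a truncated Hermitian hypothesis suffices.
-/
theorem E_conjTranspose {s : ℕ → Mat q} {N m n : ℕ} (hs : Herm s N) {p r : (Mat q)[X]}
    (hp : DegLT m p) (hr : DegLT n r) (h : m + n ≤ N + 1) : (E s p r)ᴴ = E s r p := by
  rw [E_eq_sum s p hr, E_eq_sum s r hp]
  simp only [S, ev_eq_sum _ hp, ev_eq_sum _ hr, Finset.sum_mul, Matrix.conjTranspose_sum,
    Matrix.conjTranspose_mul, Matrix.conjTranspose_conjTranspose]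
  rw [Finset.sum_comm]
  refine Finset.sum_congr rfl fun i hi => Finset.sum_congr rfl fun k hk => ?_
  rw [Finset.mem_range] at hi hk
  rw [hs (i + k) (by omega), Nat.add_comm i k, mul_assoc]

/-! ### Positivity in bounded degree -/

/-- The form of `s` is positive definite on the polynomials of degree less than `n`. -/
def PosOn (s : ℕ → Mat q) (n : ℕ) : Prop :=
  ∀ p : (Mat q)[X], DegLT n p → p ≠ 0 → 0 < (E s p p).trace

/-- The form of `s` is positive semidefinite on the polynomials of degree less than `n`. -/
def NonnegOn (s : ℕ → Mat q) (n : ℕ) : Prop :=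
  ∀ p : (Mat q)[X], DegLT n p → 0 ≤ (E s p p).trace

theorem E_zero_left (s : ℕ → Mat q) (r : (Mat q)[X]) : E s 0 r = 0 := by simp [E]

theorem PosOn.nonnegOn {s : ℕ → Mat q} {n : ℕ} (h : PosOn s n) : NonnegOn s n := by
  intro p hp
  by_cases h0 : p = 0
  · simp [h0, E_zero_left]
  · exact (h p hp h0).le

theorem PosOn.mono {s : ℕ → Mat q} {m n : ℕ} (h : PosOn s n) (hm : m ≤ n) : PosOn s m :=
  fun p hp h0 => h p (hp.mono hm) h0

theorem PosOn.eq_zero {s : ℕ → Mat q} {n : ℕ} (h : PosOn s n) {p : (Mat q)[X]} (hp : DegLT n p)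
    (h0 : (E s p p).trace = 0) : p = 0 := by
  by_contra hne
  exact (h p hp hne).ne' h0

theorem PosOn.eq_zero_of_S {s : ℕ → Mat q} {n : ℕ} (h : PosOn s n) {p : (Mat q)[X]}
    (hp : DegLT n p) (h0 : ∀ k < n, S s k p = 0) : p = 0 :=
  h.eq_zero hp (by rw [E_eq_zero s hp h0, Matrix.trace_zero])

/-! ### Remainders -/

/-- The blocks of `R(z) u₁`. -/
def Uc (s : ℕ → Mat q) (z : ℂ) : ℕ → Mat q
  | 0 => 0
  | i + 1 => z • Uc s z i - s i

theorem ev_Uc_xsub (s : ℕ → Mat q) (w z : ℂ) (p : (Mat q)[X]) :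
    ev (Uc s w) (xsub z p) = (w - z) • ev (Uc s w) p - S s 0 p := by
  rw [ev_xsub]
  simp only [Uc, ev_sub_left, ev_smul_left, S, Nat.add_zero, sub_smul]
  abel

/-- The remainder `B(w) W - U(B)(w)` of the polynomial `B`. -/
def resid (s : ℕ → Mat q) (w : ℂ) (W : Mat q) (B : (Mat q)[X]) : Mat q :=
  ev (pt q w) B * W - ev (Uc s w) B

theorem resid_add (s : ℕ → Mat q) (w : ℂ) (W : Mat q) (B D : (Mat q)[X]) :
    resid s w W (B + D) = resid s w W B + resid s w W D := by
  simp only [resid, map_add, add_mul]; abel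

theorem resid_sub (s : ℕ → Mat q) (w : ℂ) (W : Mat q) (B D : (Mat q)[X]) :
    resid s w W (B - D) = resid s w W B - resid s w W D := by
  simp only [resid, map_sub, sub_mul]; abel

theorem resid_smul (s : ℕ → Mat q) (w : ℂ) (W A : Mat q) (B : (Mat q)[X]) :
    resid s w W (A • B) = A * resid s w W B := by
  simp only [resid, ev_smul, mul_sub, mul_assoc]

/-- Formally, (t-z)/(t-w) = (w-z)/(t-w) + 1 under the integral. -/
theorem resid_xsub (s : ℕ → Mat q) (w z : ℂ) (W : Mat q) (B : (Mat q)[X]) :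
    resid s w W (xsub z B) = (w - z) • resid s w W B + S s 0 B := by
  simp only [resid, ev_pt_xsub, ev_Uc_xsub, smul_sub, smul_mul_assoc]; abel

theorem resid_one (s : ℕ → Mat q) (w : ℂ) (W : Mat q) : resid s w W 1 = W := by
  simp [resid, ev_one, pt, Uc]

theorem resid_eq_zero (s : ℕ → Mat q) (w : ℂ) {P : (Mat q)[X]} (hP : IsUnit (ev (pt q w) P)) :
    resid s w ((ev (pt q w) P)⁻¹ * ev (Uc s w) P) P = 0 := by
  rw [resid, ← mul_assoc, Matrix.mul_nonsing_inv _ ((Matrix.isUnit_iff_isUnit_det _).1 hP),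
    one_mul, sub_self]

/-! ### Invertibility off `[a, b]`: the Friedrichs case -/

theorem isUnit_of_left_cancel {A : Mat q} (h : ∀ Y : Mat q, Y * A = 0 → Y = 0) : IsUnit A := by
  rw [← Matrix.vecMul_injective_iff_isUnit]
  intro x y hxy
  have h0 : (x - y) ᵥ* A = 0 := by
    rw [Matrix.sub_vecMul]; exact sub_eq_zero.2 hxy
  have := h (Matrix.of fun _ => x - y) (by
    ext i k
    exact congrFun h0 k)
  ext i
  exact sub_eq_zero.1 (congrFun (congrFun this i) i)

/-- A complex number of the form `a + ε / β` with `0 ≤ ε ≤ (b - a) β` lies in `[a, b]`. -/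
theorem mem_Icc_of_eq_mul {a b : ℝ} {w ε β : ℂ} (hβ : 0 < β) (hε : 0 ≤ ε)
    (h : ε = (w - a) * β) (hle : ε ≤ ((b : ℂ) - a) * β) : w ∈ Complex.ofReal '' Set.Icc a b := by
  obtain ⟨β', hβ', rfl⟩ : ∃ r : ℝ, 0 < r ∧ (r : ℂ) = β := by
    rw [Complex.pos_iff] at hβ
    exact ⟨β.re, hβ.1, Complex.ext (by simp) (by simp [hβ.2])⟩
  obtain ⟨ε', hε', rfl⟩ : ∃ r : ℝ, 0 ≤ r ∧ (r : ℂ) = ε := by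
    rw [Complex.nonneg_iff] at hε
    exact ⟨ε.re, hε.1, Complex.ext (by simp) (by simp [hε.2])⟩
  have hle' : ε' ≤ (b - a) * β' := by
    rw [← Complex.ofReal_sub, ← Complex.ofReal_mul] at hle
    exact Complex.real_le_real.1 hle
  have hb0 : (β' : ℂ) ≠ 0 := by exact_mod_cast hβ'.ne'
  refine ⟨a + ε' / β', ⟨?_, ?_⟩, ?_⟩
  · have := div_nonneg hε' hβ'.le
    linarith
  · have := (div_le_iff₀ hβ').2 hle'
    linarith
  · push_cast
    rw [h, mul_div_cancel_right₀ _ hb0]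
    ring

/-- Integrate t - a = (b - a) - (b - t). -/
theorem NonnegOn.trace_sh_le {a b : ℝ} {s : ℕ → Mat q} {n : ℕ} (h : NonnegOn (bs b s) n)
    {e : (Mat q)[X]} (he : DegLT n e) :
    (E (sh a s) e e).trace ≤ ((b : ℂ) - a) * (E s e e).trace := by
  have := h e he
  rw [E_bs, E_xsub_left a, neg_sub, Matrix.trace_sub, Matrix.trace_smul, smul_eq_mul] at this
  exact sub_nonneg.1 this

/-- Polynomials `g j` (`j < m`), reproducing the value at `a`, and `p j` (`j < N`), orthogonal to
all polynomials of lower degree and with value `1` at `a`. -/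
structure OrthSys (a : ℝ) (s : ℕ → Mat q) (m N : ℕ) (g p : ℕ → (Mat q)[X]) : Prop where
  g_deg : ∀ j < m, DegLT (j + 1) (g j)
  g_S : ∀ j < m, ∀ k ≤ j, S s k (g j) = pt q a k
  p_deg : ∀ j < N, DegLT (j + 1) (p j)
  p_S : ∀ j < N, ∀ k < j, S s k (p j) = 0
  p_eval : ∀ j < N, ev (pt q a) (p j) = 1

section

variable {a b : ℝ} {s : ℕ → Mat q} {m N n : ℕ} {g p : ℕ → (Mat q)[X]} {w : ℂ}

theorem OrthSys.g_S_sh (O : OrthSys a s m N g p) {j : ℕ} (hj : j < m) {k : ℕ} (hk : k < j) :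
    S (sh a s) k (g j) = 0 := by
  rw [S_sh', O.g_S j hj _ hk, O.g_S j hj _ hk.le]
  simp [pt, smul_smul, pow_succ']

theorem OrthSys.smul_g_eq_zero (O : OrthSys a s m N g p) {j : ℕ} (hj : j < m) {Y : Mat q}
    (h : Y • g j = 0) : Y = 0 := by
  have := S_smul s 0 Y (g j)
  rw [h, O.g_S j hj 0 (Nat.zero_le j)] at this
  simpa [pt] using this.symm

theorem OrthSys.smul_p_eq_zero (O : OrthSys a s m N g p) {j : ℕ} (hj : j < N) {Y : Mat q}
    (h : Y • p j = 0) : Y = 0 := by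
  have := ev_smul (pt q a) Y (p j)
  rw [h, O.p_eval j hj] at this
  simpa using this.symm

/-- Since ⟨e, tᵏ⁺¹⟩ = ⟨(t-w)e, tᵏ⟩ + w⟨e, tᵏ⟩, vanishing propagates upwards and gains one index. -/
theorem S_eq_zero_of_xsub {e : (Mat q)[X]} (h0 : S s 0 e = 0) {j : ℕ}
    (h : ∀ k < j, S s k (xsub w e) = 0) : ∀ k ≤ j, S s k e = 0 := by
  intro k
  induction k with
  | zero => exact fun _ => h0
  | succ k ih =>
    intro hk
    have := h k hk
    rwa [S_xsub, ih (by omega), smul_zero, sub_zero] at this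

/-- `Z` makes YB - ZP vanish at w, so t - w divides it. Its remainder is zero, because those of YB
and P are, and the remainder of (t-w)e is ⟨e, 1⟩. -/
theorem exists_of_mul_resid {P B : (Mat q)[X]} (hP : IsUnit (ev (pt q w) P)) {Y : Mat q}
    (hPd : DegLT (n + 1) P) (hBd : DegLT (n + 1) B)
    (h : Y * resid s w ((ev (pt q w) P)⁻¹ * ev (Uc s w) P) B = 0) :
    ∃ (Z : Mat q) (e : (Mat q)[X]), DegLT n e ∧ Y • B - Z • P = xsub w e ∧ S s 0 e = 0 := by
  refine ⟨Y * ev (pt q w) B * (ev (pt q w) P)⁻¹, ?_⟩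
  have hf0 : ev (pt q w) (Y • B - (Y * ev (pt q w) B * (ev (pt q w) P)⁻¹) • P) = 0 := by
    rw [map_sub, ev_smul, ev_smul, mul_assoc _ _ (ev _ P),
      Matrix.nonsing_inv_mul _ ((Matrix.isUnit_iff_isUnit_det _).1 hP), mul_one, sub_self]
  obtain ⟨e, he, hfe⟩ := exists_eq_xsub ((hBd.smul Y).sub (hPd.smul _)) hf0
  refine ⟨e, he, hfe, ?_⟩
  have hU := congrArg (ev (Uc s w)) hfe
  rw [ev_Uc_xsub, sub_self, zero_smul, zero_sub, map_sub, ev_smul, ev_smul] at hU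
  rw [← neg_eq_zero, ← hU, ← neg_eq_zero, ← h, resid, mul_sub]
  simp only [mul_assoc, neg_sub]

/-- The numerical range of multiplication by `t` on polynomials of degree less than `n`. -/
theorem eq_zero_of_E_xsub (hs : PosOn s n) (hsa : PosOn (sh a s) n) (hb : NonnegOn (bs b s) n)
    (hw : w ∉ Complex.ofReal '' Set.Icc a b) {e : (Mat q)[X]} (he : DegLT n e)
    (h : E s (xsub w e) e = 0) : e = 0 := by
  by_contra h0
  refine hw (mem_Icc_of_eq_mul (hs e he h0) (hsa e he h0).le ?_ (hb.trace_sh_le he))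
  rw [E_xsub_left a, sub_eq_zero] at h
  rw [h, Matrix.trace_smul, smul_eq_mul]

/-- If Y p_n(w) = 0, then Y p_n = (t-w)e with deg e < n, hence ⟨(t-w)e, e⟩ = 0. -/
theorem OrthSys.isUnit_eval_p (O : OrthSys a s m N g p) (hn : n < N) (hs : PosOn s n)
    (hsa : PosOn (sh a s) n) (hb : NonnegOn (bs b s) n)
    (hw : w ∉ Complex.ofReal '' Set.Icc a b) : IsUnit (ev (pt q w) (p n)) := by
  refine isUnit_of_left_cancel fun Y hY => ?_
  rw [← ev_smul] at hY
  obtain ⟨e, he, hfe⟩ := exists_eq_xsub ((O.p_deg n hn).smul Y) hY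
  have : e = 0 := eq_zero_of_E_xsub hs hsa hb hw he (by
    rw [← hfe, E_smul_left, E_eq_zero s he (O.p_S n hn), mul_zero])
  rw [this, xsub_zero] at hfe
  exact O.smul_p_eq_zero hn hfe

/-- The quotient e is orthogonal to p_n by degree and to p_j by its vanishing moments, so ⟨(t-w)e,
e⟩ = 0 and e = 0. Then Y p_j = Z p_n has degree less than n and is orthogonal to itself. -/
theorem OrthSys.isUnit_resid_p (O : OrthSys a s m N g p) (hn : n < N) (hh : Herm s (2 * n))
    (hs : PosOn s n) (hsa : PosOn (sh a s) n) (hb : NonnegOn (bs b s) n)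
    (hw : w ∉ Complex.ofReal '' Set.Icc a b) {j : ℕ} (hj : j < n) :
    IsUnit (resid s w ((ev (pt q w) (p n))⁻¹ * ev (Uc s w) (p n)) (p j)) := by
  refine isUnit_of_left_cancel fun Y hY => ?_
  have hjd := O.p_deg j (hj.trans hn)
  obtain ⟨Z, e, he, hfe, he0⟩ := exists_of_mul_resid (O.isUnit_eval_p hn hs hsa hb hw)
    (O.p_deg n hn) (hjd.mono (by omega)) hY
  have hSe : ∀ k ≤ j, S s k e = 0 := S_eq_zero_of_xsub he0 fun k hk => by
    rw [← hfe, map_sub, S_smul, S_smul, O.p_S j (hj.trans hn) k hk,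
      O.p_S n hn k (by omega), mul_zero, mul_zero, sub_zero]
  have hPe : ∀ e, DegLT n e → E s (p n) e = 0 := fun e he => E_eq_zero s he (O.p_S n hn)
  have hpe : E s (p j) e = 0 := by
    rw [← E_conjTranspose hh he hjd (by omega),
      E_eq_zero s hjd fun k hk => hSe k (by omega), Matrix.conjTranspose_zero]
  have h0 : e = 0 := eq_zero_of_E_xsub hs hsa hb hw he (by
    rw [← hfe, E_sub_left, E_smul_left, E_smul_left, hPe e he, hpe, mul_zero, mul_zero, sub_zero])
  rw [h0, xsub_zero, sub_eq_zero] at hfe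
  refine O.smul_p_eq_zero (hj.trans hn) (hs.eq_zero ((hjd.mono (by omega)).smul Y) ?_)
  nth_rewrite 1 [hfe]
  rw [E_smul_left, hPe _ ((hjd.mono (by omega)).smul Y), mul_zero, Matrix.trace_zero]

/-- Here ⟨(t-w)e, e⟩ need not vanish. For (t-a)σ, Y g_j is the orthogonal projection part of e, and
with d = e - Y g_j one gets ⟨d, d⟩ = (w-a)⟨e, e⟩, the left form taken for (t-a)σ and the right one
for σ. Pythagoras bounds the trace of the left side by (b-a) tr⟨e, e⟩. -/
theorem OrthSys.isUnit_resid_g (O : OrthSys a s m N g p) (hn : n < N) (hh : Herm s (2 * n))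
    (hs : PosOn s n) (hsa : PosOn (sh a s) n) (hb : NonnegOn (bs b s) n)
    (hw : w ∉ Complex.ofReal '' Set.Icc a b) {j : ℕ} (hj : j < n) (hjm : j < m) :
    IsUnit (resid s w ((ev (pt q w) (p n))⁻¹ * ev (Uc s w) (p n)) (xsub a (g j))) := by
  refine isUnit_of_left_cancel fun Y hY => ?_
  have hjd := O.g_deg j hjm
  have hjn : DegLT n (g j) := hjd.mono (by omega)
  obtain ⟨Z, e, he, hfe, he0⟩ := exists_of_mul_resid (O.isUnit_eval_p hn hs hsa hb hw)
    (O.p_deg n hn) ((hjd.xsub a).mono (by omega)) hY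
  have hSf : ∀ k < n, S s k (xsub w e) = Y * S (sh a s) k (g j) := fun k hk => by
    rw [← hfe, map_sub, S_smul, S_smul, O.p_S n hn k hk, mul_zero, sub_zero, S_sh]
  have hSe : ∀ k ≤ j, S s k e = 0 := S_eq_zero_of_xsub he0 fun k hk => by
    rw [hSf k (by omega), O.g_S_sh hjm hk, mul_zero]
  have hd : DegLT n (e - Y • g j) := he.sub (hjn.smul Y)
  have hh' : Herm (sh a s) (2 * n - 1) := Herm.sh (by rwa [Nat.sub_add_cancel (by omega)]) a
  have hdg : E (sh a s) (e - Y • g j) (g j) = 0 := E_eq_zero _ hjd fun k hk => by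
    rw [map_sub, S_smul, ← hSf k (by omega), S_sh', S_xsub, hSe k (by omega)]
    simp
  have hgd : E (sh a s) (g j) (e - Y • g j) = 0 := by
    rw [← E_conjTranspose hh' hd hjn (by omega), hdg, Matrix.conjTranspose_zero]
  have hsplit : E (sh a s) e e = E (sh a s) (e - Y • g j) (e - Y • g j) +
      E (sh a s) (Y • g j) (Y • g j) := by
    have : e = (e - Y • g j) + Y • g j := by abel
    conv_lhs => rw [this]
    rw [E_add_left, E_add_right, E_add_right, E_smul_right _ _ (e - Y • g j), hdg,
      E_smul_left _ _ _ (e - Y • g j), hgd]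
    simp
  have hx : E s (xsub w e) e = E (sh a s) (Y • g j) (Y • g j) := by
    rw [← hfe, E_sub_left, E_smul_left, E_smul_left s Z, E_eq_zero s he (O.p_S n hn), mul_zero,
      sub_zero, ← E_sh, E_smul_left, ← sub_eq_zero, ← mul_sub, ← E_sub_right, hgd, mul_zero]
  have hδ : E (sh a s) (e - Y • g j) (e - Y • g j) = (w - a) • E s e e := by
    rw [E_xsub_left a, hsplit, sub_eq_iff_eq_add'] at hx
    rw [add_comm] at hx
    exact add_left_cancel (hx.trans (add_comm _ _))
  have h0 : e = 0 := by
    by_contra h0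
    refine hw (mem_Icc_of_eq_mul (hs e he h0) (hsa.nonnegOn _ hd)
      (by rw [hδ, Matrix.trace_smul, smul_eq_mul]) (le_trans ?_ (hb.trace_sh_le he)))
    rw [hsplit, Matrix.trace_add]
    exact le_add_of_nonneg_right (hsa.nonnegOn _ (hjn.smul Y))
  rw [h0, xsub_zero, E_zero_left] at hx
  exact O.smul_g_eq_zero hjm (hsa.eq_zero (hjn.smul Y) (by rw [← hx, Matrix.trace_zero]))

end

/-! ### Invertibility off `[a, b]`: the Krein case -/

section

variable {a b : ℝ} {s : ℕ → Mat q} {m N n : ℕ} {g p : ℕ → (Mat q)[X]} {w : ℂ}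

theorem E_sh_sh (a : ℝ) (s : ℕ → Mat q) (p r : (Mat q)[X]) :
    E (sh a (sh a s)) p r = E s (xsub a p) (xsub a r) := by
  rw [E_sh, E_sh, E_xsub]

theorem PosOn.sh_sh (hs : PosOn s (n + 1)) : PosOn (sh a (sh a s)) n := by
  intro d hd h0
  rw [E_sh_sh]
  exact hs _ (hd.xsub a) fun h => h0 (eq_zero_of_xsub_eq_zero h)

theorem sub_ne_zero_of_notMem (hab : a < b) (hw : w ∉ Complex.ofReal '' Set.Icc a b) :
    w - a ≠ 0 := fun h => hw ⟨a, ⟨le_rfl, hab.le⟩, (sub_eq_zero.1 h).symm⟩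

/-- g_n is orthogonal to lower degrees for (t-a)σ, so the argument for p_n applies to that form. -/
theorem OrthSys.isUnit_eval_g (O : OrthSys a s m N g p) (hn : n < m) (hs : PosOn s (n + 1))
    (hsa : PosOn (sh a s) n) (hb : NonnegOn (bs b (sh a s)) n)
    (hw : w ∉ Complex.ofReal '' Set.Icc a b) : IsUnit (ev (pt q w) (g n)) := by
  refine isUnit_of_left_cancel fun Y hY => ?_
  rw [← ev_smul] at hY
  obtain ⟨e, he, hfe⟩ := exists_eq_xsub ((O.g_deg n hn).smul Y) hY
  have : e = 0 := eq_zero_of_E_xsub hsa hs.sh_sh hb hw he (by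
    rw [← hfe, E_smul_left, E_eq_zero _ he fun k hk => O.g_S_sh hn hk, mul_zero])
  rw [this, xsub_zero] at hfe
  exact O.smul_g_eq_zero hn hfe

theorem OrthSys.isUnit_eval_xsub_g (O : OrthSys a s m N g p) (hab : a < b) (hn : n < m)
    (hs : PosOn s (n + 1)) (hsa : PosOn (sh a s) n) (hb : NonnegOn (bs b (sh a s)) n)
    (hw : w ∉ Complex.ofReal '' Set.Icc a b) : IsUnit (ev (pt q w) (xsub a (g n))) := by
  have hx := sub_ne_zero_of_notMem hab hw
  rw [ev_pt_xsub]
  exact (O.isUnit_eval_g hn hs hsa hb hw).smul (Units.mk0 _ hx)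

theorem OrthSys.isUnit_krein_resid_g (O : OrthSys a s m N g p) (hab : a < b) (hn : n < m)
    (hh : Herm s (2 * n + 1)) (hs : PosOn s (n + 1)) (hsa : PosOn (sh a s) n)
    (hb : NonnegOn (bs b (sh a s)) n) (hw : w ∉ Complex.ofReal '' Set.Icc a b)
    {j : ℕ} (hj : j < n) :
    IsUnit (resid s w ((ev (pt q w) (xsub a (g n)))⁻¹ * ev (Uc s w) (xsub a (g n)))
      (xsub a (g j))) := by
  have hx := sub_ne_zero_of_notMem hab hw
  refine isUnit_of_left_cancel fun Y hY => ?_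
  have hjm : j < m := hj.trans hn
  have hjd := O.g_deg j hjm
  obtain ⟨Z, e, he, hfe, he0⟩ := exists_of_mul_resid (n := n + 1)
    (O.isUnit_eval_xsub_g hab hn hs hsa hb hw)
    ((O.g_deg n hn).xsub a) ((hjd.xsub a).mono (by omega)) hY
  have hSe : ∀ k ≤ j, S s k e = 0 := S_eq_zero_of_xsub he0 fun k hk => by
    rw [← hfe, map_sub, S_smul, S_smul, ← S_sh, ← S_sh, O.g_S_sh hjm hk,
      O.g_S_sh hn (hk.trans hj), mul_zero, mul_zero, sub_zero]
  -- At t = a the left side of `hfe` vanishes while a - w ≠ 0, so e = (t-a)d and the problem moves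
  -- to the form of (t-a)σ.
  have hea : ev (pt q a) e = 0 := by
    have h := congrArg (ev (pt q a)) hfe
    rw [ev_pt_xsub, map_sub, ev_smul, ev_smul, ev_pt_xsub, ev_pt_xsub] at h
    simp only [sub_self, zero_smul, mul_zero] at h
    refine (smul_eq_zero.1 h.symm).resolve_left fun h' => hx ?_
    rw [← neg_sub, h', neg_zero]
  obtain ⟨d, hd, rfl⟩ := exists_eq_xsub he hea
  have hgn : ∀ d, DegLT n d → E (sh a s) (g n) d = 0 := fun d hd =>
    E_eq_zero _ hd fun k hk => O.g_S_sh hn hk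
  have hgd : E (sh a s) (g j) d = 0 := by
    rw [E_sh, E_xsub, ← E_conjTranspose hh he (hjd.mono (show j + 1 ≤ n by omega)) (by omega),
      E_eq_zero s hjd fun k hk => hSe k (by omega), Matrix.conjTranspose_zero]
  have h0 : d = 0 := eq_zero_of_E_xsub hsa hs.sh_sh hb hw hd (by
    rw [E_sh, xsub_comm, ← hfe, E_sub_left, E_smul_left, E_smul_left, ← E_sh, ← E_sh, hgn d hd,
      hgd, mul_zero, mul_zero, sub_zero])
  rw [h0, xsub_zero, xsub_zero, sub_eq_zero] at hfe
  have hYg : DegLT n (Y • g j) := (hjd.mono (by omega)).smul Y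
  refine O.smul_g_eq_zero hjm (hsa.eq_zero hYg ?_)
  rw [E_sh, xsub_smul, hfe, E_smul_left, ← E_sh, hgn _ hYg, mul_zero, Matrix.trace_zero]

/-- Write e = c p_j + (t-a)d with c = e(a), and let ⟨·,·⟩_k be the form of (t-a)ᵏσ. Then ⟨e, e⟩_0 =
(w-a)⟨d, d⟩_1, while e ⊥ p_j gives ⟨d, d⟩_2 = ⟨e, e⟩_0 + ⟨c p_j, c p_j⟩_0. Hence tr⟨e, e⟩_0 ≤ (b-a)
tr⟨d, d⟩_1, which forces d = 0, e = 0 and Y = 0. -/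
theorem OrthSys.isUnit_krein_resid_p (O : OrthSys a s m N g p) (hab : a < b) (hn : n < m)
    (hh : Herm s (2 * n + 1)) (hs : PosOn s (n + 1)) (hsa : PosOn (sh a s) n)
    (hb : NonnegOn (bs b (sh a s)) n) (hw : w ∉ Complex.ofReal '' Set.Icc a b)
    {j : ℕ} (hj : j ≤ n) (hjN : j < N) :
    IsUnit (resid s w ((ev (pt q w) (xsub a (g n)))⁻¹ * ev (Uc s w) (xsub a (g n))) (p j)) := by
  refine isUnit_of_left_cancel fun Y hY => ?_
  have hjd := O.p_deg j hjN
  obtain ⟨Z, e, he, hfe, he0⟩ := exists_of_mul_resid (n := n + 1)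
    (O.isUnit_eval_xsub_g hab hn hs hsa hb hw)
    ((O.g_deg n hn).xsub a) (hjd.mono (by omega)) hY
  have hSe : ∀ k ≤ j, S s k e = 0 := S_eq_zero_of_xsub he0 fun k hk => by
    rw [← hfe, map_sub, S_smul, S_smul, ← S_sh, O.p_S j hjN k hk,
      O.g_S_sh hn (by omega), mul_zero, mul_zero, sub_zero]
  set c := ev (pt q a) e with hc
  have hY' : Y = -((w - a) • c) := by
    have h := congrArg (ev (pt q a)) hfe
    rw [ev_pt_xsub, map_sub, ev_smul, ev_smul, ev_pt_xsub, O.p_eval j hjN] at h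
    simp only [sub_self, zero_smul, mul_zero, sub_zero, mul_one] at h
    rw [h, ← neg_smul, neg_sub]
  obtain ⟨d, hd, hqd⟩ := exists_eq_xsub (z := a)
    (he.sub ((hjd.mono (show j + 1 ≤ n + 1 by omega)).smul c)) (by
      rw [map_sub, ev_smul, O.p_eval j hjN, mul_one, hc, sub_self])
  have hep : E s e (p j) = 0 := E_eq_zero s hjd fun k hk => hSe k (by omega)
  have hpe : E s (p j) e = 0 := by
    rw [← E_conjTranspose hh he hjd (by omega), hep, Matrix.conjTranspose_zero]
  have hε : E s e e = (w - a) • E (sh a s) d d := by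
    have h1 : E s (xsub w e) d = Y * E s (p j) d := by
      rw [← hfe, E_sub_left, E_smul_left, E_smul_left, ← E_sh,
        E_eq_zero _ hd fun k hk => O.g_S_sh hn hk, mul_zero, sub_zero]
    have h2 : E s e d = c * E s (p j) d + E (sh a s) d d := by
      rw [E_sh, ← hqd, E_sub_left, E_smul_left]; abel
    rw [E_xsub_left a, E_sh, E_xsub, ← hqd, E_sub_right, E_smul_right, hep, zero_mul, sub_zero,
      h2, hY', smul_add, neg_mul, smul_mul_assoc, sub_eq_iff_eq_add] at h1
    rw [h1]; abel
  have hq : E (sh a (sh a s)) d d = E s e e + E s (c • p j) (c • p j) := by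
    rw [E_sh_sh, ← hqd, E_sub_left, E_sub_right, E_sub_right, E_smul_right _ _ e, hep,
      E_smul_left _ _ _ e, hpe]
    simp
  have h0 : d = 0 := by
    by_contra h0
    refine hw (mem_Icc_of_eq_mul (hsa d hd h0) (hs.nonnegOn _ he)
      (by rw [hε, Matrix.trace_smul, smul_eq_mul]) (le_trans ?_ (hb.trace_sh_le hd)))
    rw [hq, Matrix.trace_add]
    exact le_add_of_nonneg_right (hs.nonnegOn _ ((hjd.mono (by omega)).smul c))
  have he' : e = 0 := hs.eq_zero he (by
    rw [hε, h0, E_zero_left, smul_zero, Matrix.trace_zero])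
  rw [hY', hc, he', map_zero, smul_zero, neg_zero]

end

/-! ### Continued fractions -/

theorem contFrac_cons (c : Mat q) {t : List (Mat q)} (h : t ≠ []) :
    contFrac (c :: t) = c + (contFrac t)⁻¹ := by
  cases t with
  | nil => exact absurd rfl h
  | cons d t => rfl

theorem contFracDefined_cons (c : Mat q) {t : List (Mat q)} (h : t ≠ []) :
    ContFracDefined (c :: t) ↔ IsUnit (contFrac t) ∧ ContFracDefined t := by
  cases t with
  | nil => exact absurd rfl h
  | cons d t => rfl

/-- The terms `cM 0, cL 0, …, cM (n - 1), cL (n - 1)`. -/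
def altList (cM cL : ℕ → Mat q) (n : ℕ) : List (Mat q) :=
  (List.range n).flatMap fun j => [cM j, cL j]

theorem altList_succ (cM cL : ℕ → Mat q) (n : ℕ) :
    altList cM cL (n + 1) =
      cM 0 :: cL 0 :: altList (fun j => cM (j + 1)) (fun j => cL (j + 1)) n := by
  simp [altList, List.range_succ_eq_map, List.flatMap_map]

theorem altList_succ_last (cM cL : ℕ → Mat q) (n : ℕ) :
    altList cM cL (n + 1) = altList cM cL n ++ [cM n, cL n] := by
  simp [altList, List.range_succ]

/-- One step of a continued fraction in terms of the remainders `x, y, z` with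
`z = y c + x`: if the tail is `-z⁻¹ y`, the fraction is `-y⁻¹ x`. -/
theorem add_inv_tail {x y z c : Mat q} (hy : IsUnit y) (hz : IsUnit z) (h : z = y * c + x) :
    IsUnit (-(z⁻¹ * y)) ∧ c + (-(z⁻¹ * y))⁻¹ = -(y⁻¹ * x) := by
  have hy' := (Matrix.isUnit_iff_isUnit_det _).1 hy
  have hz' := (Matrix.isUnit_iff_isUnit_det _).1 hz
  have hzi : IsUnit z⁻¹ := (Matrix.isUnit_nonsing_inv_iff).2 hz
  refine ⟨(hzi.mul hy).neg, ?_⟩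
  have : (-(z⁻¹ * y))⁻¹ = -(y⁻¹ * z) := by
    refine Matrix.inv_eq_right_inv ?_
    rw [neg_mul_neg, mul_assoc, Matrix.mul_nonsing_inv_cancel_left _ _ hy',
      Matrix.nonsing_inv_mul _ hz']
  rw [this, h, mul_add, Matrix.nonsing_inv_mul_cancel_left _ _ hy']
  abel

theorem tail_last {x y c : Mat q} (hy : IsUnit y) (h : 0 = y * c + x) : c = -(y⁻¹ * x) := by
  have hy' := (Matrix.isUnit_iff_isUnit_det _).1 hy
  have hx : x = -(y * c) := eq_neg_of_add_eq_zero_right h.symm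
  rw [hx, mul_neg, Matrix.nonsing_inv_mul_cancel_left _ _ hy', neg_neg]

/-- `add_inv_tail` climbs one level at a time; ρ_{n+1} = 0 makes `cL n` the last term. In
`contFrac_altList_append`, τ_{n+1} = 0 stops the fraction one term earlier. -/
theorem contFrac_altList {cM cL ρ τ : ℕ → Mat q} (n : ℕ)
    (hτ : ∀ j ≤ n, τ (j + 1) = ρ j * cM j + τ j)
    (hρ : ∀ j ≤ n, ρ (j + 1) = τ (j + 1) * cL j + ρ j)
    (uρ : ∀ j ≤ n, IsUnit (ρ j)) (uτ : ∀ j ≤ n, IsUnit (τ (j + 1))) (h0 : ρ (n + 1) = 0) :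
    ContFracDefined (altList cM cL (n + 1)) ∧
      contFrac (altList cM cL (n + 1)) = -((ρ 0)⁻¹ * τ 0) := by
  induction n generalizing cM cL ρ τ with
  | zero =>
    have hL : cL 0 = -((τ 1)⁻¹ * ρ 0) := tail_last (uτ 0 le_rfl) (by rw [← hρ 0 le_rfl, h0])
    obtain ⟨h1, h2⟩ := add_inv_tail (uρ 0 le_rfl) (uτ 0 le_rfl) (hτ 0 le_rfl)
    rw [← hL] at h1 h2
    exact ⟨⟨h1, trivial⟩, h2⟩
  | succ n ih =>
    obtain ⟨hd, hv⟩ := ih (cM := fun j => cM (j + 1)) (cL := fun j => cL (j + 1))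
      (ρ := fun j => ρ (j + 1)) (τ := fun j => τ (j + 1))
      (fun j hj => hτ (j + 1) (by omega)) (fun j hj => hρ (j + 1) (by omega))
      (fun j hj => uρ (j + 1) (by omega)) (fun j hj => uτ (j + 1) (by omega)) h0
    have hne : altList (fun j => cM (j + 1)) (fun j => cL (j + 1)) (n + 1) ≠ [] := by
      simp [altList_succ]
    obtain ⟨h1, h2⟩ := add_inv_tail (uτ 0 (by omega)) (uρ 1 (by omega)) (hρ 0 (by omega))
    obtain ⟨h3, h4⟩ := add_inv_tail (uρ 0 (by omega)) (uτ 0 (by omega)) (hτ 0 (by omega))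
    rw [← hv, ← contFrac_cons _ hne] at h2
    rw [← h2] at h3 h4
    rw [← hv] at h1
    rw [altList_succ, contFrac_cons _ (by simp), contFracDefined_cons _ (by simp),
      contFracDefined_cons _ hne]
    exact ⟨⟨h3, h1, hd⟩, h4⟩

theorem contFrac_altList_append {cM cL ρ τ : ℕ → Mat q} (n : ℕ)
    (hτ : ∀ j ≤ n, τ (j + 1) = ρ j * cM j + τ j)
    (hρ : ∀ j < n, ρ (j + 1) = τ (j + 1) * cL j + ρ j)
    (uρ : ∀ j ≤ n, IsUnit (ρ j)) (uτ : ∀ j < n, IsUnit (τ (j + 1))) (h0 : τ (n + 1) = 0) :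
    ContFracDefined (altList cM cL n ++ [cM n]) ∧
      contFrac (altList cM cL n ++ [cM n]) = -((ρ 0)⁻¹ * τ 0) := by
  induction n generalizing cM cL ρ τ with
  | zero => exact ⟨trivial, tail_last (uρ 0 le_rfl) (h0.symm.trans (hτ 0 le_rfl))⟩
  | succ n ih =>
    obtain ⟨hd, hv⟩ := ih (cM := fun j => cM (j + 1)) (cL := fun j => cL (j + 1))
      (ρ := fun j => ρ (j + 1)) (τ := fun j => τ (j + 1))
      (fun j hj => hτ (j + 1) (by omega)) (fun j hj => hρ (j + 1) (by omega))
      (fun j hj => uρ (j + 1) (by omega)) (fun j hj => uτ (j + 1) (by omega)) h0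
    have hne : altList (fun j => cM (j + 1)) (fun j => cL (j + 1)) n ++ [cM (n + 1)] ≠ [] := by
      simp
    obtain ⟨h1, h2⟩ := add_inv_tail (uτ 0 (by omega)) (uρ 1 (by omega)) (hρ 0 (by omega))
    obtain ⟨h3, h4⟩ := add_inv_tail (uρ 0 (by omega)) (uτ 0 (by omega)) (hτ 0 (by omega))
    rw [← hv, ← contFrac_cons _ hne] at h2
    rw [← h2] at h3 h4
    rw [← hv] at h1
    rw [altList_succ, List.cons_append, List.cons_append, contFrac_cons _ (by simp),
      contFracDefined_cons _ (by simp), contFracDefined_cons _ hne]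
    exact ⟨⟨h3, h1, hd⟩, h4⟩

/-! ### Block matrices as polynomials and moments -/

/-- The matrix polynomial whose coefficients are the blocks of a block row. -/
def rowPoly {j : ℕ} (A : BlockRow q j) : (Mat q)[X] :=
  ∑ k : Fin (j + 1), Polynomial.monomial k (Matrix.of fun i l => A i (k, l))

theorem rowPoly_degLT {j : ℕ} (A : BlockRow q j) : DegLT (j + 1) (rowPoly A) := by
  intro i hi
  rw [rowPoly, Polynomial.finsetSum_coeff]
  refine Finset.sum_eq_zero fun k _ => ?_
  rw [Polynomial.coeff_monomial, if_neg (by have := k.2; omega)]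

theorem rowPoly_coeff {j : ℕ} (A : BlockRow q j) (k : Fin (j + 1)) :
    (rowPoly A).coeff k = Matrix.of fun i l => A i (k, l) := by
  rw [rowPoly, Polynomial.finsetSum_coeff, Finset.sum_eq_single k]
  · rw [Polynomial.coeff_monomial, if_pos rfl]
  · intro b _ hb
    rw [Polynomial.coeff_monomial, if_neg fun h => hb (Fin.ext h)]
  · simp

theorem ev_rowPoly (c : ℕ → Mat q) {j : ℕ} (A : BlockRow q j) :
    ev c (rowPoly A) = A * blockCol c j := by
  rw [ev_eq_sum c (rowPoly_degLT A), Finset.sum_range fun i => (rowPoly A).coeff i * c i]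
  ext i l
  simp only [rowPoly_coeff, Matrix.sum_apply, Matrix.mul_apply, Fintype.sum_prod_type, blockCol,
    Matrix.of_apply]

theorem S_rowPoly (s c : ℕ → Mat q) {j : ℕ} (A : BlockRow q j)
    (h : A * hankel s 0 j = (blockCol c j)ᴴ) {k : ℕ} (hk : k ≤ j) :
    S s k (rowPoly A) = (c k)ᴴ := by
  rw [S, ev_rowPoly]
  ext i l
  have := congrFun (congrFun h i) (⟨k, by omega⟩, l)
  simpa [Matrix.mul_apply, hankel, blockCol] using this

theorem rowPoly_neg {j : ℕ} (A : BlockRow q j) : rowPoly (-A) = -rowPoly A := by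
  rw [rowPoly, rowPoly, ← Finset.sum_neg_distrib]
  refine Finset.sum_congr rfl fun k _ => ?_
  rw [← map_neg]; rfl

theorem rowPoly_appendId {j : ℕ} (A : BlockRow q j) :
    rowPoly (appendId A) = rowPoly A + Polynomial.monomial (j + 1) 1 := by
  rw [rowPoly, Fin.sum_univ_castSucc, rowPoly]
  congr 1
  · refine Finset.sum_congr rfl fun k _ => ?_
    simp [appendId]
  · simp only [appendId, Matrix.of_apply, Fin.lastCases_last, Fin.val_last]
    rfl

/-- A left null vector, repeated in every row, is a polynomial whose moments up to order j vanish.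
-/
theorem isUnit_hankel {s : ℕ → Mat q} {j : ℕ} (h : PosOn s (j + 1)) :
    IsUnit (hankel s 0 j).det := by
  rw [← Matrix.isUnit_iff_isUnit_det, ← Matrix.vecMul_injective_iff_isUnit]
  intro x y hxy
  have h0 : (x - y) ᵥ* hankel s 0 j = 0 := by
    rw [Matrix.sub_vecMul]; exact sub_eq_zero.2 hxy
  set A : BlockRow q j := Matrix.of fun _ => x - y with hA
  have hAH : A * hankel s 0 j = (blockCol (fun _ => 0) j)ᴴ := by
    ext i k
    exact (congrFun h0 k).trans (by simp [blockCol])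
  have hp : rowPoly A = 0 := h.eq_zero_of_S (rowPoly_degLT A) fun k hk => by
    rw [S_rowPoly s _ A hAH (by omega), Matrix.conjTranspose_zero]
  ext ⟨k, l⟩
  have hk := rowPoly_coeff A k
  rw [hp, Polynomial.coeff_zero] at hk
  have := congrFun (congrFun hk l) l
  exact sub_eq_zero.1 this.symm

theorem T_mulVec (j : ℕ) (x : Fin (j + 1) × Fin q → ℂ) (l : Fin q) :
    ∀ i (hi : i < j + 1), (T q j *ᵥ x) (⟨i, hi⟩, l) =
      match i, hi with
      | 0, _ => 0
      | i + 1, hi => x (⟨i, by omega⟩, l)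
  | 0, hi => by simp [T, Matrix.mulVec, dotProduct]
  | i + 1, hi => by
    simp only [T, Matrix.mulVec, dotProduct, Matrix.of_apply]
    rw [Finset.sum_eq_single (⟨i, by omega⟩, l)]
    · simp
    · rintro ⟨k, l'⟩ _ hne
      rw [if_neg, zero_mul]
      rintro ⟨h1, h2⟩
      simp only [Nat.add_right_cancel_iff] at h1
      exact hne (by subst h2; simp [h1])
    · simp

/-- A null vector satisfies x = zTx, so its blocks vanish successively from the top. -/
theorem isUnit_one_sub_T (j : ℕ) (z : ℂ) : IsUnit (1 - z • T q j).det := by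
  rw [← Matrix.isUnit_iff_isUnit_det, ← Matrix.mulVec_injective_iff_isUnit]
  intro x y hxy
  have h0 : ∀ i, (x - y) i = z * (T q j *ᵥ (x - y)) i := by
    intro i
    have : (1 - z • T q j) *ᵥ (x - y) = 0 := by
      rw [Matrix.mulVec_sub]; exact sub_eq_zero.2 hxy
    have := congrFun this i
    rw [Matrix.sub_mulVec, Matrix.one_mulVec, Matrix.smul_mulVec] at this
    exact sub_eq_zero.1 this
  have key : ∀ i (hi : i < j + 1) l, (x - y) (⟨i, hi⟩, l) = 0 := by
    intro i
    induction i with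
    | zero => intro hi l; rw [h0, T_mulVec]; simp
    | succ i ih => intro hi l; rw [h0, T_mulVec]; simp only [ih (by omega) l, mul_zero]
  ext ⟨⟨i, hi⟩, l⟩
  exact sub_eq_zero.1 (key i hi l)

/-- The blocks of `R(z) c`. -/
def conv (z : ℂ) (c : ℕ → Mat q) : ℕ → Mat q
  | 0 => c 0
  | i + 1 => z • conv z c i + c (i + 1)

theorem R_mul_blockCol (j : ℕ) (z : ℂ) (c : ℕ → Mat q) :
    R q j z * blockCol c j = blockCol (conv z c) j := by
  have h : (1 - z • T q j) * blockCol (conv z c) j = blockCol c j := by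
    ext ⟨⟨i, hi⟩, l⟩ k
    have hT : (T q j * blockCol (conv z c) j) (⟨i, hi⟩, l) k =
      (T q j *ᵥ fun x => blockCol (conv z c) j x k) (⟨i, hi⟩, l) := rfl
    rw [Matrix.sub_mul, Matrix.one_mul, Matrix.smul_mul, Matrix.sub_apply, Matrix.smul_apply, hT, T_mulVec]
    cases i with
    | zero => simp [blockCol, conv]
    | succ i => simp [blockCol, conv]
  rw [R, ← h, Matrix.nonsing_inv_mul_cancel_left _ _ (isUnit_one_sub_T j z)]

theorem R_mul_v (j : ℕ) (z : ℂ) : R q j z * v q j = blockCol (pt q z) j := by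
  rw [v, R_mul_blockCol]
  congr 1
  funext i
  induction i with
  | zero => simp [conv, pt]
  | succ i ih => simp [conv, ih, pt, smul_smul, pow_succ']

theorem R_mul_u1 (s : ℕ → Mat q) (j : ℕ) (z : ℂ) : R q j z * u1 s j = blockCol (Uc s z) j := by
  rw [u1, R_mul_blockCol]
  congr 1
  funext i
  induction i with
  | zero => simp [conv, Uc]
  | succ i ih => simp [conv, ih, Uc, sub_eq_add_neg]

theorem R_mul_uTilde2 (a : ℝ) (s : ℕ → Mat q) (j : ℕ) (z : ℂ) :
    R q j z * uTilde2 a s j = blockCol (fun i => Uc s z (i + 1) - (a : ℂ) • Uc s z i) j := by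
  rw [uTilde2, R_mul_blockCol]
  congr 1
  funext i
  induction i with
  | zero => simp [conv, Uc]
  | succ i ih =>
    simp only [conv, ih, Uc, smul_sub, smul_smul, mul_comm z]
    abel

/-- The monic polynomials orthogonal with respect to `s`. -/
def monicOrth (s : ℕ → Mat q) : ℕ → (Mat q)[X]
  | 0 => 1
  | j + 1 => rowPoly (appendId (-((Y1 s j)ᴴ * (H1 s j)⁻¹)))

theorem P1_eq (s : ℕ → Mat q) (n : ℕ) (z : ℂ) : P1 s n z = ev (pt q z) (monicOrth s n) := by
  cases n with
  | zero => simp [P1, monicOrth, ev_one, pt]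
  | succ n => rw [P1, monicOrth, Matrix.mul_assoc, R_mul_v, ev_rowPoly]

theorem Q1_eq (s : ℕ → Mat q) (n : ℕ) (z : ℂ) : Q1 s n z = -ev (Uc s z) (monicOrth s n) := by
  cases n with
  | zero => simp [Q1, monicOrth, ev_one, Uc]
  | succ n => rw [Q1, monicOrth, Matrix.mul_assoc, R_mul_u1, ev_rowPoly]

theorem K2_eq (a : ℝ) (s : ℕ → Mat q) (j : ℕ) : K2 a s j = hankel (sh a s) 0 j := by
  ext l k
  simp [K2, hankel, sh]
  ring

theorem YTilde2_eq (a : ℝ) (s : ℕ → Mat q) (j : ℕ) : YTilde2 a s j = Y1 (sh a s) j := by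
  rw [YTilde2, Y1]
  congr 1
  funext i
  rw [sh, neg_smul, neg_add_eq_sub, show j + 2 + i = j + 1 + i + 1 by omega]

theorem Gamma2_eq_P1 (a : ℝ) (s : ℕ → Mat q) (n : ℕ) (z : ℂ) :
    Gamma2 a s n z = P1 (sh a s) n z := by
  cases n with
  | zero => rfl
  | succ n => rw [Gamma2, P1, YTilde2_eq, K2_eq, H1]

theorem Gamma2_eq (a : ℝ) (s : ℕ → Mat q) (n : ℕ) (z : ℂ) :
    Gamma2 a s n z = ev (pt q z) (monicOrth (sh a s) n) := by
  rw [Gamma2_eq_P1, P1_eq]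

theorem Theta2_eq (a : ℝ) (s : ℕ → Mat q) (n : ℕ) (z : ℂ) :
    Theta2 a s n z = ev (Uc s z) (xsub a (monicOrth (sh a s) n)) := by
  rw [ev_xsub, ← ev_smul_left, ← ev_sub_left]
  cases n with
  | zero => simp [Theta2, monicOrth, ev_one, Uc]
  | succ n => rw [Theta2, monicOrth, Matrix.mul_assoc, R_mul_uTilde2, ev_rowPoly, YTilde2_eq, K2_eq, H1]

theorem monicOrth_degLT (s : ℕ → Mat q) (n : ℕ) : DegLT (n + 1) (monicOrth s n) := by
  cases n with
  | zero => exact DegLT.one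
  | succ n => exact rowPoly_degLT _

theorem monicOrth_coeff (s : ℕ → Mat q) (n : ℕ) : (monicOrth s n).coeff n = 1 := by
  cases n with
  | zero => simp [monicOrth]
  | succ n =>
    rw [monicOrth, rowPoly_appendId, Polynomial.coeff_add, rowPoly_degLT _ _ le_rfl, zero_add,
      Polynomial.coeff_monomial, if_pos rfl]

/-- The row -Y*H⁻¹ solves the normal equations cancelling the moments of the leading monomial. -/
theorem monicOrth_S {s : ℕ → Mat q} {n : ℕ} (hs : PosOn s n) (hh : Herm s (2 * n)) {k : ℕ}
    (hk : k < n) : S s k (monicOrth s n) = 0 := by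
  cases n with
  | zero => omega
  | succ n =>
    have hA : (Y1 s n)ᴴ * (H1 s n)⁻¹ * hankel s 0 n = (Y1 s n)ᴴ := by
      rw [H1, Matrix.nonsing_inv_mul_cancel_right _ _ (isUnit_hankel hs)]
    rw [monicOrth, rowPoly_appendId, rowPoly_neg, map_add, map_neg,
      S_rowPoly s (fun i => s (n + 1 + i)) _ hA (by omega), hh _ (by omega)]
    have : S s k (Polynomial.monomial (n + 1) 1) = s (n + 1 + k) := by
      simp [S, ev]
    rw [this, neg_add_cancel]

/-! ### The two families and their recurrences -/

/-- The polynomial of degree `j` reproducing values at `a`. -/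
def reproPoly (a : ℝ) (s : ℕ → Mat q) (j : ℕ) : (Mat q)[X] :=
  rowPoly ((v q j)ᴴ * (R q j a)ᴴ * (H1 s j)⁻¹)

/-- The polynomial `h` of degree `j` such that `1 - (t - a) h` is orthogonal to all polynomials of
degree at most `j`. -/
def dualPoly (a : ℝ) (s : ℕ → Mat q) (j : ℕ) : (Mat q)[X] :=
  rowPoly (-((uTilde2 a s j)ᴴ * (R q j a)ᴴ * (K2 a s j)⁻¹))

/-- The orthogonal polynomials with respect to `s`, normalized to have value `1` at `a`. -/
def normOrth (a : ℝ) (s : ℕ → Mat q) : ℕ → (Mat q)[X]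
  | 0 => 1
  | j + 1 => 1 - xsub a (dualPoly a s j)

theorem R_mul_uTilde2_self (a : ℝ) (s : ℕ → Mat q) (j : ℕ) :
    R q j a * uTilde2 a s j = blockCol (fun i => -s i) j := by
  rw [R_mul_uTilde2]
  simp [Uc]

theorem blockCol_neg (c : ℕ → Mat q) (j : ℕ) : blockCol (fun i => -c i) j = -blockCol c j := rfl

theorem MSum_eq (a : ℝ) (s : ℕ → Mat q) (j : ℕ) :
    MSum a s j = ev (pt q a) (reproPoly a s j) := by
  rw [MSum, reproPoly, Matrix.mul_assoc _ (R q j a), R_mul_v, ev_rowPoly]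

theorem LSum_eq (a : ℝ) (s : ℕ → Mat q) (j : ℕ) : LSum a s j = S s 0 (dualPoly a s j) := by
  rw [LSum, dualPoly, Matrix.mul_assoc _ (R q j a), R_mul_uTilde2_self, S, ev_rowPoly, blockCol_neg,
    Matrix.mul_neg, Matrix.neg_mul]
  rfl

theorem reproPoly_S (a : ℝ) {s : ℕ → Mat q} {j : ℕ} (hs : PosOn s (j + 1)) {k : ℕ} (hk : k ≤ j) :
    S s k (reproPoly a s j) = pt q a k := by
  rw [reproPoly, S_rowPoly s (pt q a) _ _ hk]
  · simp [pt]
  · rw [H1, Matrix.nonsing_inv_mul_cancel_right _ _ (isUnit_hankel hs),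
      ← Matrix.conjTranspose_mul, R_mul_v]

theorem dualPoly_S {a : ℝ} {s : ℕ → Mat q} {j : ℕ} (hs : PosOn (sh a s) (j + 1))
    (hh : Herm s (j + 1)) {k : ℕ} (hk : k ≤ j) : S (sh a s) k (dualPoly a s j) = s k := by
  rw [dualPoly, S_rowPoly _ s _ _ hk, hh k (by omega)]
  rw [K2_eq, Matrix.neg_mul, Matrix.nonsing_inv_mul_cancel_right _ _ (isUnit_hankel hs),
    ← Matrix.conjTranspose_mul, R_mul_uTilde2_self, blockCol_neg, Matrix.conjTranspose_neg, neg_neg]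

theorem orthSys {a : ℝ} {s : ℕ → Mat q} {m N : ℕ} (hs : PosOn s m) (hsa : PosOn (sh a s) N)
    (hh : Herm s N) : OrthSys a s m (N + 1) (reproPoly a s) (normOrth a s) where
  g_deg j _ := rowPoly_degLT _
  g_S j hj k hk := reproPoly_S a (hs.mono hj) hk
  p_deg j hj := by
    cases j with
    | zero => exact DegLT.one
    | succ j => exact (DegLT.one.mono (by omega)).sub ((rowPoly_degLT _).xsub a)
  p_S j hj k hk := by
    cases j with
    | zero => omega
    | succ j =>
      rw [normOrth, map_sub, S_one, ← S_sh,
        dualPoly_S (hsa.mono (by omega)) (fun i hi => hh i (by omega)) (by omega), sub_self]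
  p_eval j hj := by
    cases j with
    | zero => simp [normOrth, ev_one, pt]
    | succ j => simp [normOrth, ev_one, ev_pt_xsub, pt]

/-- Uniqueness principle for g_j: identities between its multiples reduce to comparing ⟨·, 1⟩. -/
theorem eq_zero_of_S_sh {a : ℝ} {s : ℕ → Mat q} {j : ℕ} (hs : PosOn s (j + 1))
    {f : (Mat q)[X]} (hf : DegLT (j + 1) f) (h0 : S s 0 f = 0)
    (h : ∀ k < j, S (sh a s) k f = 0) : f = 0 :=
  hs.eq_zero_of_S hf fun k hk =>
    S_eq_zero_of_xsub (w := a) h0 (fun k hk => by rw [← S_sh]; exact h k hk) k (by omega)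

/-- Uniqueness principle for p_j: identities between its multiples reduce to comparing values at a.
-/
theorem eq_zero_of_eval {a : ℝ} {s : ℕ → Mat q} {j : ℕ} (hsa : PosOn (sh a s) j)
    {f : (Mat q)[X]} (hf : DegLT (j + 1) f) (h0 : ev (pt q a) f = 0)
    (h : ∀ k < j, S s k f = 0) : f = 0 := by
  obtain ⟨e, he, rfl⟩ := exists_eq_xsub hf h0
  rw [hsa.eq_zero_of_S he fun k hk => by rw [S_sh]; exact h k hk, xsub_zero]

/-- Consecutive `dualPoly`s have the same low moments for (t-a)σ, so their difference is a left
multiple of g_j. Pairing with 1 identifies the factor, as `LSum` is that pairing. -/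
theorem normOrth_succ {a : ℝ} {s : ℕ → Mat q} {j : ℕ} (hs : PosOn s (j + 1))
    (hsa : PosOn (sh a s) (j + 1)) (hh : Herm s (j + 1)) :
    normOrth a s (j + 1) = normOrth a s j - L a s j • xsub a (reproPoly a s j) := by
  have O := orthSys hs (hsa.mono (Nat.le_succ j)) (fun i hi => hh i (by omega))
  have hg0 : S s 0 (reproPoly a s j) = 1 := by
    rw [reproPoly_S a hs (Nat.zero_le j)]; simp [pt]
  cases j with
  | zero =>
    have : dualPoly a s 0 - L a s 0 • reproPoly a s 0 = 0 := by
      refine eq_zero_of_S_sh (a := a) hs ((rowPoly_degLT _).sub ((rowPoly_degLT _).smul _)) ?_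
        (by simp)
      rw [map_sub, S_smul, hg0, L, LSum_eq, mul_one, sub_self]
    rw [normOrth, normOrth, ← xsub_smul, sub_eq_zero.1 this]
  | succ j =>
    have : dualPoly a s (j + 1) - dualPoly a s j - L a s (j + 1) • reproPoly a s (j + 1) = 0 := by
      refine eq_zero_of_S_sh (a := a) hs (((rowPoly_degLT _).sub
        ((rowPoly_degLT _).mono (by omega))).sub ((rowPoly_degLT _).smul _)) ?_ fun k hk => ?_
      · rw [map_sub, map_sub, S_smul, hg0, L, LSum_eq, LSum_eq, mul_one, sub_self]
      · rw [map_sub, map_sub, S_smul, O.g_S_sh (by omega) hk, mul_zero, sub_zero,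
          dualPoly_S hsa hh (by omega), dualPoly_S (hsa.mono (by omega))
          (fun i hi => hh i (by omega)) (by omega), sub_self]
    rw [sub_eq_zero, sub_eq_iff_eq_add] at this
    rw [normOrth, normOrth, ← xsub_smul, this, xsub_add]
    abel

theorem reproPoly_zero (a : ℝ) {s : ℕ → Mat q} (hs : PosOn s 1) :
    reproPoly a s 0 = M a s 0 • normOrth a s 0 := by
  have hC : reproPoly a s 0 = Polynomial.C ((reproPoly a s 0).coeff 0) := by
    ext1 i
    rcases i with _ | i
    · simp
    · rw [Polynomial.coeff_C_succ]; exact rowPoly_degLT _ _ (by omega)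
  have h := reproPoly_S a hs (le_refl 0)
  rw [hC, S, ev_C] at h
  simp only [pt, pow_zero, one_smul, Nat.add_zero] at h
  rw [hC, M, normOrth, Matrix.inv_eq_left_inv h, Polynomial.smul_eq_C_mul, mul_one]

/-- g_{j+1} - g_j is orthogonal to degrees up to j, hence a left multiple of p_{j+1}. The value at a
identifies the factor, as `MSum` is g_j(a). -/
theorem reproPoly_succ {a : ℝ} {s : ℕ → Mat q} {j : ℕ} (hs : PosOn s (j + 2))
    (hsa : PosOn (sh a s) (j + 1)) (hh : Herm s (j + 1)) :
    reproPoly a s (j + 1) = reproPoly a s j + M a s (j + 1) • normOrth a s (j + 1) := by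
  have O := orthSys hs hsa hh
  have : reproPoly a s (j + 1) - reproPoly a s j - M a s (j + 1) • normOrth a s (j + 1) = 0 := by
    refine eq_zero_of_eval hsa ((((rowPoly_degLT _).sub
      ((rowPoly_degLT _).mono (by omega))).sub ((O.p_deg _ (by omega)).smul _))) ?_ fun k hk => ?_
    · rw [map_sub, map_sub, ev_smul, O.p_eval _ (by omega), M, MSum_eq, MSum_eq, mul_one, sub_self]
    · rw [map_sub, map_sub, S_smul, O.p_S _ (by omega) k hk, O.g_S _ (by omega) k (by omega),
        O.g_S j (by omega) k (by omega), sub_self, mul_zero, sub_zero]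
  rw [sub_eq_zero, sub_eq_iff_eq_add] at this
  rw [this, add_comm]

/-! ### The Hausdorff conditions in terms of the forms -/

/-- Each diagonal entry of ⟨p, p⟩ is the Hankel quadratic form at one conjugated row of
coefficients; one nonzero row makes the trace positive. -/
theorem posOn_of_posDef {s : ℕ → Mat q} {j : ℕ} (h : (hankel s 0 j).PosDef) :
    PosOn s (j + 1) := by
  intro p hp h0
  have hE : ∀ i, E s p p i i = star (fun x : Fin (j + 1) × Fin q => star (p.coeff x.1 i x.2)) ⬝ᵥ
      (hankel s 0 j *ᵥ fun x : Fin (j + 1) × Fin q => star (p.coeff x.1 i x.2)) := by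
    intro i
    rw [Matrix.dotProduct_mulVec, E_eq_sum s p hp,
      Finset.sum_range fun k => S s k p * (p.coeff k)ᴴ, Matrix.sum_apply, dotProduct,
      Fintype.sum_prod_type]
    refine Finset.sum_congr rfl fun k _ => ?_
    rw [Matrix.mul_apply]
    refine Finset.sum_congr rfl fun l _ => ?_
    congr 1
    rw [S, ev_eq_sum _ hp, Finset.sum_range fun i => p.coeff i * s (i + k), Matrix.sum_apply,
      Matrix.vecMul, dotProduct, Fintype.sum_prod_type]
    simp [Matrix.mul_apply, hankel]
  obtain ⟨k, hk⟩ : ∃ k, p.coeff k ≠ 0 := by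
    by_contra hne
    push Not at hne
    exact h0 (Polynomial.ext fun i => by simp [hne i])
  have hkj : k < j + 1 := by
    by_contra hlt
    exact hk (hp k (by omega))
  obtain ⟨i, l, hil⟩ : ∃ i l, p.coeff k i l ≠ 0 := by
    by_contra hne
    push Not at hne
    exact hk (Matrix.ext hne)
  rw [Matrix.trace]
  refine Finset.sum_pos' (fun i _ => ?_) ⟨i, Finset.mem_univ i, ?_⟩
  · rw [Matrix.diag_apply, hE]
    exact h.posSemidef.dotProduct_mulVec_nonneg _
  · rw [Matrix.diag_apply, hE]
    refine h.dotProduct_mulVec_pos fun hx => hil ?_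
    simpa using congrFun hx (⟨k, hkj⟩, l)

theorem herm_of_isHermitian {s : ℕ → Mat q} {j : ℕ} (h : (hankel s 0 j).IsHermitian) :
    Herm s (2 * j + 1) := by
  intro k hk
  obtain ⟨i, hi, l, hl, rfl⟩ : ∃ i, i < j + 1 ∧ ∃ l, l < j + 1 ∧ k = l + i :=
    ⟨min k j, by omega, k - min k j, by omega, by omega⟩
  ext x y
  have := congrFun (congrFun h (⟨l, hl⟩, x)) (⟨i, hi⟩, y)
  simpa [hankel, Nat.add_comm i l] using this

theorem isHermitian_hankel {s : ℕ → Mat q} {j : ℕ} (h : Herm s (2 * j + 1)) :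
    (hankel s 0 j)ᴴ = hankel s 0 j := by
  ext x y
  have := congrFun (congrFun (h (x.1 + y.1) (by omega)) x.2) y.2
  simpa [hankel, Nat.add_comm (y.1 : ℕ)] using this

theorem bs_sh (a b : ℝ) (s : ℕ → Mat q) : bs b (sh a s) = sh a (bs b s) := by
  funext k
  simp only [bs, sh, smul_sub, smul_smul, mul_comm (b : ℂ)]
  abel

/-- Integrate b - a = (b - t) + (t - a). -/
theorem posOn_of_bs_sh {a b : ℝ} (hab : a < b) {s : ℕ → Mat q} {n : ℕ}
    (hb : NonnegOn (bs b s) n) (ha : NonnegOn (sh a s) n)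
    (h : PosOn (bs b s) n ∨ PosOn (sh a s) n) : PosOn s n := by
  intro p hp h0
  have hsum : ((b - a : ℝ) : ℂ) * (E s p p).trace =
      (E (bs b s) p p).trace + (E (sh a s) p p).trace := by
    rw [E_bs, E_xsub_left a, Matrix.trace_neg, Matrix.trace_sub, Matrix.trace_smul, smul_eq_mul]
    push_cast
    ring
  have hpos : 0 < ((b - a : ℝ) : ℂ) * (E s p p).trace := by
    rw [hsum]
    rcases h with h | h
    · exact add_pos_of_pos_of_nonneg (h p hp h0) (ha p hp)
    · exact add_pos_of_nonneg_of_pos (hb p hp) (h p hp h0)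
  have hba : (0 : ℂ) < ((b - a : ℝ) : ℂ) := by
    exact_mod_cast sub_pos.2 hab
  exact pos_of_mul_pos_right hpos hba.le

theorem NonnegOn.bs_bs {b : ℝ} {s : ℕ → Mat q} {n : ℕ} (h : NonnegOn s (n + 1)) :
    NonnegOn (bs b (bs b s)) n := by
  intro p hp
  rw [E_bs, E_bs, neg_neg, E_xsub]
  exact h _ (hp.xsub b)

theorem K1_eq (b : ℝ) (s : ℕ → Mat q) (j : ℕ) : K1 b s j = hankel (bs b s) 0 j := by
  ext l k
  simp [K1, hankel, bs]

theorem sHat_eq (a b : ℝ) (s : ℕ → Mat q) (j : ℕ) : sHat a b s j = sh a (bs b s) j := by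
  simp only [sHat, sh, bs, smul_sub, smul_smul, add_smul, neg_smul]
  abel

theorem H2_eq (a b : ℝ) (s : ℕ → Mat q) (j : ℕ) : H2 a b s j = hankel (sh a (bs b s)) 0 j := by
  ext l k
  have := congrFun (congrFun (sHat_eq a b s (l.1 + k.1)) l.2) k.2
  simpa [H2, hankel, sHat] using this

/-! ### The parameters are Hermitian -/

theorem MSum_conjTranspose {a : ℝ} {s : ℕ → Mat q} {j : ℕ} (h : Herm s (2 * j + 1)) :
    (MSum a s j)ᴴ = MSum a s j := by
  simp [MSum, H1, Matrix.conjTranspose_mul, Matrix.conjTranspose_nonsing_inv,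
    isHermitian_hankel h, Matrix.mul_assoc]

theorem LSum_conjTranspose {a : ℝ} {s : ℕ → Mat q} {j : ℕ} (h : Herm s (2 * j + 2)) :
    (LSum a s j)ᴴ = LSum a s j := by
  simp [LSum, K2_eq, Matrix.conjTranspose_mul, Matrix.conjTranspose_nonsing_inv,
    isHermitian_hankel (h.sh a), Matrix.mul_assoc]

theorem M_conjTranspose {a : ℝ} {s : ℕ → Mat q} {j : ℕ} (h : Herm s (2 * j + 1)) :
    (M a s j)ᴴ = M a s j := by
  cases j with
  | zero => rw [M, Matrix.conjTranspose_nonsing_inv, h 0 (by omega)]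
  | succ j =>
    rw [M, Matrix.conjTranspose_sub, MSum_conjTranspose h,
      MSum_conjTranspose fun k hk => h k (by omega)]

theorem L_conjTranspose {a : ℝ} {s : ℕ → Mat q} {j : ℕ} (h : Herm s (2 * j + 2)) :
    (L a s j)ᴴ = L a s j := by
  cases j with
  | zero => rw [L, LSum_conjTranspose h]
  | succ j =>
    rw [L, Matrix.conjTranspose_sub, LSum_conjTranspose h,
      LSum_conjTranspose fun k hk => h k (by omega)]

/-! ### Monic and normalized orthogonal polynomials -/

theorem isUnit_of_monicOrth_eq {s : ℕ → Mat q} {n : ℕ} {A : Mat q} {f : (Mat q)[X]}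
    (h : monicOrth s n = A • f) : IsUnit A := by
  have := monicOrth_coeff s n
  rw [h, Polynomial.coeff_smul, smul_eq_mul] at this
  exact IsUnit.of_mul_eq_one _ this

/-- Both sides satisfy the same orthogonality; A is the value at a, invertible because the left side
is monic. -/
theorem exists_monicOrth_eq_normOrth {a : ℝ} {s : ℕ → Mat q} {n : ℕ} (hs : PosOn s n)
    (hsa : PosOn (sh a s) n) (hh : Herm s (2 * n)) :
    ∃ A : Mat q, IsUnit A ∧ monicOrth s n = A • normOrth a s n := by
  have O := orthSys hs hsa fun k hk => hh k (by omega)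
  have : monicOrth s n = ev (pt q a) (monicOrth s n) • normOrth a s n := by
    rw [← sub_eq_zero]
    refine eq_zero_of_eval hsa ((monicOrth_degLT s n).sub ((O.p_deg n (by omega)).smul _)) ?_
      fun k hk => ?_
    · rw [map_sub, ev_smul, O.p_eval n (by omega), mul_one, sub_self]
    · rw [map_sub, S_smul, O.p_S n (by omega) k hk, monicOrth_S hs hh hk, mul_zero, sub_zero]
  exact ⟨_, isUnit_of_monicOrth_eq this, this⟩

theorem exists_monicOrth_eq_reproPoly {a : ℝ} {s : ℕ → Mat q} {n : ℕ} (hs : PosOn s (n + 1))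
    (hsa : PosOn (sh a s) n) (hh : Herm s (2 * n + 1)) :
    ∃ A : Mat q, IsUnit A ∧ monicOrth (sh a s) n = A • reproPoly a s n := by
  have O := orthSys hs hsa fun k hk => hh k (by omega)
  have : monicOrth (sh a s) n = S s 0 (monicOrth (sh a s) n) • reproPoly a s n := by
    rw [← sub_eq_zero]
    refine eq_zero_of_S_sh (a := a) hs
      ((monicOrth_degLT _ n).sub ((O.g_deg n (by omega)).smul _)) ?_ fun k hk => ?_
    · rw [map_sub, S_smul, O.g_S n (by omega) 0 (Nat.zero_le n)]
      simp [pt]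
    · rw [map_sub, S_smul, O.g_S_sh (by omega) hk, monicOrth_S hsa (hh.sh a) hk, mul_zero, sub_zero]
  exact ⟨_, isUnit_of_monicOrth_eq this, this⟩

/-! ### The remainders -/

/-- The remainders of the orthogonal polynomials. -/
def rhoSeq (a : ℝ) (s : ℕ → Mat q) (z : ℂ) (W : Mat q) (j : ℕ) : Mat q :=
  (resid s (star z) W (normOrth a s j))ᴴ

/-- The negative remainders of the polynomials `(t - a) gⱼ`, with `gⱼ` reproducing the value
at `a`. -/
def tauSeq (a : ℝ) (s : ℕ → Mat q) (z : ℂ) (W : Mat q) : ℕ → Mat q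
  | 0 => -1
  | j + 1 => -(resid s (star z) W (xsub a (reproPoly a s j)))ᴴ

theorem rhoSeq_zero (a : ℝ) (s : ℕ → Mat q) (z : ℂ) (W : Mat q) : rhoSeq a s z W 0 = Wᴴ := by
  rw [rhoSeq, normOrth, resid_one]

/-- `resid_xsub` adds the moment ⟨p_j, 1⟩, which is zero for j ≥ 1. For j = 0 it is s_0, and M_0 s_0
= 1 accounts for the initial value τ_0 = -1. -/
theorem tauSeq_succ {a : ℝ} {s : ℕ → Mat q} {z : ℂ} {W : Mat q} {j : ℕ} (hs : PosOn s (j + 1))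
    (hsa : PosOn (sh a s) j) (hh : Herm s (2 * j + 1)) :
    tauSeq a s z W (j + 1) = rhoSeq a s z W j * (-(z - (a : ℂ)) • M a s j) + tauSeq a s z W j := by
  have hM := M_conjTranspose (a := a) hh
  cases j with
  | zero =>
    have h1 : M a s 0 * s 0 = 1 := by
      have := reproPoly_S a hs (le_refl 0)
      rw [reproPoly_zero a hs, S_smul, normOrth, S_one] at this
      simpa [pt] using this
    rw [show tauSeq a s z W (0 + 1) = -(resid s (star z) W (xsub a (reproPoly a s 0)))ᴴ from rfl,
      reproPoly_zero a hs, xsub_smul, resid_smul, resid_xsub, rhoSeq, tauSeq, normOrth, S_one, mul_add, h1, Matrix.conjTranspose_add, Matrix.conjTranspose_mul, hM]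
    simp [sub_smul, sub_mul, mul_sub]
    abel
  | succ j =>
    have O := orthSys hs hsa fun k hk => hh k (by omega)
    rw [tauSeq, reproPoly_succ hs hsa fun k hk => hh k (by omega), xsub_add, resid_add, xsub_smul,
      resid_smul, resid_xsub s _ _ _ (normOrth a s (j + 1)),
      O.p_S (j + 1) (by omega) 0 (by omega), rhoSeq, tauSeq,
      Matrix.conjTranspose_add, Matrix.conjTranspose_mul, hM]
    simp [sub_smul, sub_mul, mul_sub]

theorem rhoSeq_succ {a : ℝ} {s : ℕ → Mat q} {z : ℂ} {W : Mat q} {j : ℕ} (hs : PosOn s (j + 1))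
    (hsa : PosOn (sh a s) (j + 1)) (hh : Herm s (2 * j + 2)) :
    rhoSeq a s z W (j + 1) = tauSeq a s z W (j + 1) * L a s j + rhoSeq a s z W j := by
  rw [rhoSeq, normOrth_succ hs hsa fun k hk => hh k (by omega), resid_sub, resid_smul, rhoSeq,
    tauSeq, Matrix.conjTranspose_sub, Matrix.conjTranspose_mul, L_conjTranspose hh, neg_mul]
  abel

theorem star_notMem {a b : ℝ} {z : ℂ} (hz : z ∉ Complex.ofReal '' Set.Icc a b) :
    star z ∉ Complex.ofReal '' Set.Icc a b := by
  rintro ⟨x, hx, h⟩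
  refine hz ⟨x, hx, ?_⟩
  rw [← star_star z, ← h]
  simp

theorem inv_scaled {ρ τ : Mat q} {β : ℂ} (hβ : β ≠ 0) (hρ : IsUnit ρ) (hτ : τ = -1) :
    IsUnit (-(ρ⁻¹ * (β • τ))) ∧ (-(ρ⁻¹ * (β • τ)))⁻¹ = β⁻¹ • ρ := by
  have hρ' := (Matrix.isUnit_iff_isUnit_det _).1 hρ
  have h : -(ρ⁻¹ * (β • τ)) * (β⁻¹ • ρ) = 1 := by
    simp [hτ, smul_smul, hβ, Matrix.nonsing_inv_mul _ hρ']
  exact ⟨IsUnit.of_mul_eq_one _ h, Matrix.inv_eq_right_inv h⟩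

/-- The continued fraction of the odd Friedrichs solution, with alternating scaling of the
terms. -/
theorem friedrichsOdd_contFrac {a b : ℝ} {s : ℕ → Mat q} {n : ℕ} {z : ℂ}
    (hh : Herm s (2 * n + 2)) (hs : PosOn s (n + 1)) (hsa : PosOn (sh a s) (n + 1))
    (hb : NonnegOn (bs b s) (n + 1)) (hz : z ∉ Complex.ofReal '' Set.Icc a b) {β : ℂ}
    (hβ : β ≠ 0) {cM cL : ℕ → Mat q} (hM : ∀ j, cM j = β • (-(z - (a : ℂ)) • M a s j))
    (hL : ∀ j, cL j = β⁻¹ • L a s j) :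
    IsUnit (denFriedrichsOdd s n z) ∧ ContFracDefined (altList cM cL (n + 1)) ∧
      IsUnit (contFrac (altList cM cL (n + 1))) ∧
      (contFrac (altList cM cL (n + 1)))⁻¹ = β⁻¹ • friedrichsOdd s n z := by
  have hw := star_notMem hz
  have O := orthSys hs hsa fun k hk => hh k (by omega)
  have hP := O.isUnit_eval_p (by omega) hs hsa hb hw
  obtain ⟨A, hA, hAeq⟩ := exists_monicOrth_eq_normOrth hs hsa hh
  have hA' : IsUnit Aᴴ := hA.star
  set W := (ev (pt q (star z)) (normOrth a s (n + 1)))⁻¹ *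
    ev (Uc s (star z)) (normOrth a s (n + 1)) with hW
  have hval : friedrichsOdd s n z = Wᴴ := by
    rw [friedrichsOdd, denFriedrichsOdd, Q1_eq, P1_eq, hAeq, ev_smul, ev_smul,
      Matrix.conjTranspose_neg, neg_mul, neg_neg, Matrix.conjTranspose_mul,
      Matrix.conjTranspose_mul, Matrix.mul_inv_rev, mul_assoc, Matrix.mul_nonsing_inv_cancel_left
        _ _ ((Matrix.isUnit_iff_isUnit_det _).1 hA'), hW, Matrix.conjTranspose_mul,
      Matrix.conjTranspose_nonsing_inv]
  have hden : IsUnit (denFriedrichsOdd s n z) := by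
    rw [denFriedrichsOdd, P1_eq, hAeq, ev_smul]
    exact (hA.mul hP).star
  have uρ : ∀ j ≤ n, IsUnit (rhoSeq a s z W j) := fun j hj =>
    (O.isUnit_resid_p (by omega) hh hs hsa hb hw (by omega)).star
  have uτ : ∀ j ≤ n, IsUnit (tauSeq a s z W (j + 1)) := fun j hj =>
    ((O.isUnit_resid_g (by omega) hh hs hsa hb hw (by omega) (by omega)).star).neg
  have h0 : rhoSeq a s z W (n + 1) = 0 := by
    rw [rhoSeq, hW, resid_eq_zero s _ hP, Matrix.conjTranspose_zero]
  -- Scaling only τ by β multiplies the M terms by β and the L terms by β⁻¹, as the family built on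
  -- (b-t)σ requires.
  obtain ⟨hd, hv⟩ := contFrac_altList (cM := cM) (cL := cL) (ρ := rhoSeq a s z W)
    (τ := fun j => β • tauSeq a s z W j) n
    (fun j hj => by
      rw [hM, tauSeq_succ (hs.mono (by omega)) (hsa.mono (by omega)) fun k hk => hh k (by omega),
        smul_add, mul_smul_comm β])
    (fun j hj => by
      rw [hL, rhoSeq_succ (hs.mono (by omega)) (hsa.mono (by omega)) fun k hk => hh k (by omega),
        smul_mul_smul_comm, mul_inv_cancel₀ hβ, one_smul])
    uρ (fun j hj => (uτ j hj).smul (Units.mk0 β hβ)) h0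
  obtain ⟨h1, h2⟩ := inv_scaled hβ (uρ 0 (Nat.zero_le n)) (show tauSeq a s z W 0 = -1 from rfl)
  rw [hv, h2, hval, ← rhoSeq_zero a s z W]
  exact ⟨hden, hd, h1, rfl⟩

/-- The continued fraction of the even Krein solution, with alternating scaling of the terms. -/
theorem kreinEven_contFrac {a b : ℝ} (hab : a < b) {s : ℕ → Mat q} {n : ℕ} {z : ℂ}
    (hh : Herm s (2 * n + 1)) (hs : PosOn s (n + 1)) (hsa : PosOn (sh a s) n)
    (hb : NonnegOn (bs b (sh a s)) n) (hz : z ∉ Complex.ofReal '' Set.Icc a b) {β : ℂ}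
    (hβ : β ≠ 0) {cM cL : ℕ → Mat q} (hM : ∀ j, cM j = β • (-(z - (a : ℂ)) • M a s j))
    (hL : ∀ j, cL j = β⁻¹ • L a s j) :
    IsUnit (denKreinEven a s n z) ∧ ContFracDefined (altList cM cL n ++ [cM n]) ∧
      IsUnit (contFrac (altList cM cL n ++ [cM n])) ∧
      (contFrac (altList cM cL n ++ [cM n]))⁻¹ = β⁻¹ • kreinEven a s n z := by
  have hw := star_notMem hz
  have O := orthSys hs hsa fun k hk => hh k (by omega)
  have hP := O.isUnit_eval_xsub_g hab (Nat.lt_succ_self n) hs hsa hb hw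
  obtain ⟨A, hA, hAeq⟩ := exists_monicOrth_eq_reproPoly hs hsa hh
  have hA' : IsUnit Aᴴ := hA.star
  set W := (ev (pt q (star z)) (xsub a (reproPoly a s n)))⁻¹ *
    ev (Uc s (star z)) (xsub a (reproPoly a s n)) with hW
  have hdeq : denKreinEven a s n z =
      (A * ev (pt q (star z)) (xsub a (reproPoly a s n)))ᴴ := by
    rw [denKreinEven, Gamma2_eq, hAeq, ev_smul, ev_pt_xsub]
    simp
  have hval : kreinEven a s n z = Wᴴ := by
    rw [kreinEven, hdeq, Theta2_eq, hAeq, xsub_smul, ev_smul, Matrix.conjTranspose_mul,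
      Matrix.conjTranspose_mul, Matrix.mul_inv_rev, mul_assoc, Matrix.mul_nonsing_inv_cancel_left
        _ _ ((Matrix.isUnit_iff_isUnit_det _).1 hA'), hW, Matrix.conjTranspose_mul,
      Matrix.conjTranspose_nonsing_inv]
  have hden : IsUnit (denKreinEven a s n z) := by
    rw [hdeq]
    exact (hA.mul hP).star
  have uρ : ∀ j ≤ n, IsUnit (rhoSeq a s z W j) := fun j hj =>
    (O.isUnit_krein_resid_p hab (Nat.lt_succ_self n) hh hs hsa hb hw hj (by omega)).star
  have uτ : ∀ j < n, IsUnit (tauSeq a s z W (j + 1)) := fun j hj =>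
    ((O.isUnit_krein_resid_g hab (Nat.lt_succ_self n) hh hs hsa hb hw hj).star).neg
  have h0 : tauSeq a s z W (n + 1) = 0 := by
    rw [tauSeq, hW, resid_eq_zero s _ hP, Matrix.conjTranspose_zero, neg_zero]
  obtain ⟨hd, hv⟩ := contFrac_altList_append (cM := cM) (cL := cL) (ρ := rhoSeq a s z W)
    (τ := fun j => β • tauSeq a s z W j) n
    (fun j hj => by
      rw [hM, tauSeq_succ (hs.mono (by omega)) (hsa.mono (by omega)) fun k hk => hh k (by omega),
        smul_add, mul_smul_comm β])
    (fun j hj => by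
      rw [hL, rhoSeq_succ (hs.mono (by omega)) (hsa.mono (by omega)) fun k hk => hh k (by omega),
        smul_mul_smul_comm, mul_inv_cancel₀ hβ, one_smul])
    uρ (fun j hj => (uτ j hj).smul (Units.mk0 β hβ)) (by rw [h0, smul_zero])
  obtain ⟨h1, h2⟩ := inv_scaled hβ (uρ 0 (Nat.zero_le n)) (show tauSeq a s z W 0 = -1 from rfl)
  rw [hv, h2, hval, ← rhoSeq_zero a s z W]
  exact ⟨hden, hd, h1, rfl⟩

/-! ### Reduction of the second family to the first -/

theorem YTilde1_eq (b : ℝ) (s : ℕ → Mat q) (j : ℕ) : YTilde1 b s j = Y1 (bs b s) j := by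
  rw [YTilde1, Y1]
  congr 1
  funext i
  rw [bs, show j + 2 + i = j + 1 + i + 1 by omega]

theorem Gamma1_eq (b : ℝ) (s : ℕ → Mat q) (n : ℕ) (z : ℂ) :
    Gamma1 b s n z = P1 (bs b s) n z := by
  cases n with
  | zero => rfl
  | succ n => rw [Gamma1, P1, YTilde1_eq, K1_eq, H1]

theorem P2_eq (a b : ℝ) (s : ℕ → Mat q) (n : ℕ) (z : ℂ) :
    P2 a b s n z = Gamma2 a (bs b s) n z := by
  rw [Gamma2_eq_P1]
  cases n with
  | zero => rfl
  | succ n =>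
    have : Y2 a b s n = Y1 (sh a (bs b s)) n := by
      rw [Y2, Y1]
      simp only [sHat_eq]
    rw [P2, P1, this, H2_eq, H1]

theorem blockCol_mul (c : ℕ → Mat q) (B : Mat q) (j : ℕ) :
    blockCol c j * B = blockCol (fun i => c i * B) j := by
  ext i k
  simp [blockCol, Matrix.mul_apply]

theorem uTilde1_eq (b : ℝ) (s : ℕ → Mat q) (j : ℕ) :
    uTilde1 b s j = v q j * s 0 + u1 (bs b s) j := by
  rw [v, blockCol_mul]
  ext ⟨⟨i, hi⟩, l⟩ k
  cases i with
  | zero => simp [uTilde1, u1, blockCol]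
  | succ i => simp [uTilde1, u1, blockCol, bs]

theorem u2_add (a b : ℝ) (s : ℕ → Mat q) (j : ℕ) :
    u2 a b s j + (a : ℂ) • (v q j * s 0) = uTilde2 a (bs b s) j := by
  rw [v, blockCol_mul]
  ext ⟨⟨i, hi⟩, l⟩ k
  cases i with
  | zero =>
    simp [uTilde2, u2, blockCol, bs]
    ring
  | succ i =>
    simp [uTilde2, u2, blockCol, sHat_eq, sh]
    ring

theorem Theta1_eq (b : ℝ) (s : ℕ → Mat q) (n : ℕ) (z : ℂ) :
    Theta1 b s n z = Gamma1 b s n z * s 0 - Q1 (bs b s) n z := by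
  cases n with
  | zero => simp [Theta1, Gamma1, Q1]
  | succ n =>
    rw [Gamma1_eq, P1, Q1, Theta1, uTilde1_eq, Matrix.mul_add, sub_neg_eq_add]
    rw [YTilde1_eq, K1_eq, H1, ← Matrix.mul_assoc]

/-- By `u2_add`, u_2 + z v s_0 is ũ_2 for (b-t)σ plus (z-a) v s_0; the latter becomes s_0/(b-z)
after division. -/
theorem Q2_eq (a b : ℝ) (s : ℕ → Mat q) (n : ℕ) (z : ℂ) :
    Q2 a b s n z = -(Theta2 a (bs b s) n z + (z - a) • (P2 a b s n z * s 0)) := by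
  cases n with
  | zero =>
    simp only [Q2, Theta2, P2, bs, one_mul, sub_smul, add_smul, neg_smul, zero_add]
    abel
  | succ n =>
    have h : u2 a b s (n + 1) + z • (v q (n + 1) * s 0) =
        uTilde2 a (bs b s) (n + 1) + (z - a) • (v q (n + 1) * s 0) := by
      rw [← u2_add, sub_smul]; abel
    have hY : Y2 a b s n = YTilde2 a (bs b s) n := by
      rw [YTilde2_eq, Y2, Y1]
      simp only [sHat_eq]
    rw [Q2, h, Theta2, P2, hY, H2_eq, K2_eq, Matrix.mul_add, Matrix.mul_smul, ← Matrix.mul_assoc]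

theorem m_eq (a b : ℝ) {s : ℕ → Mat q} (h : PosOn (bs b s) 1) (j : ℕ) :
    m a b s j = M a (bs b s) j := by
  have hS : ∀ j, mSum a b s j = MSum a (bs b s) j := fun j => by rw [mSum, MSum, K1_eq, H1]
  cases j with
  | zero =>
    rw [m, hS, MSum_eq, reproPoly_zero a h, ev_smul, normOrth, ev_one]
    simp [pt]
  | succ j => rw [m, M, hS, hS]

theorem l_eq (a b : ℝ) {s : ℕ → Mat q} (h : (s 0)ᴴ = s 0) (j : ℕ) :
    l a b s j = L a (bs b s) j := by
  have hS : ∀ j, lSum a b s j = LSum a (bs b s) j := fun j => by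
    have : (u2 a b s j)ᴴ + (a : ℂ) • (s 0 * (v q j)ᴴ) = (uTilde2 a (bs b s) j)ᴴ := by
      rw [← u2_add, Matrix.conjTranspose_add, Matrix.conjTranspose_smul, Matrix.conjTranspose_mul,
        h]
      simp
    rw [lSum, LSum, H2_eq, K2_eq, u2_add, this]
  cases j with
  | zero => exact hS 0
  | succ j => rw [l, L, hS, hS]

theorem smul_inv_of_isUnit {A : Mat q} (hA : IsUnit A) {β : ℂ} (hβ : β ≠ 0) :
    (β • A)⁻¹ = β⁻¹ • A⁻¹ := by
  refine Matrix.inv_eq_right_inv ?_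
  rw [smul_mul_smul_comm, mul_inv_cancel₀ hβ, one_smul,
    Matrix.mul_nonsing_inv _ ((Matrix.isUnit_iff_isUnit_det _).1 hA)]

theorem right_sub_ne_zero_of_notMem {a b : ℝ} {z : ℂ} (hab : a < b)
    (hz : z ∉ Complex.ofReal '' Set.Icc a b) : (b : ℂ) - z ≠ 0 :=
  fun h => hz ⟨b, ⟨hab.le, le_rfl⟩, sub_eq_zero.1 h⟩

theorem friedrichsEven_succ {b : ℝ} {s : ℕ → Mat q} {n : ℕ} {z : ℂ} (hβ : (b : ℂ) - z ≠ 0)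
    (h0 : (s 0)ᴴ = s 0) (h : IsUnit (denFriedrichsOdd (bs b s) n z)) :
    IsUnit (denFriedrichsEven b s (n + 1) z) ∧ friedrichsEven b s (n + 1) z =
      ((b : ℂ) - z)⁻¹ • s 0 + ((b : ℂ) - z)⁻¹ • friedrichsOdd (bs b s) n z := by
  have hd : denFriedrichsEven b s (n + 1) z = ((b : ℂ) - z) • denFriedrichsOdd (bs b s) n z := by
    rw [denFriedrichsEven, denFriedrichsOdd, Gamma1_eq]
  have hd' : (P1 (bs b s) (n + 1) (star z))ᴴ = denFriedrichsOdd (bs b s) n z := rfl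
  refine ⟨hd ▸ h.smul (Units.mk0 _ hβ), ?_⟩
  rw [friedrichsEven, hd, smul_inv_of_isUnit h hβ, Theta1_eq, Gamma1_eq, Matrix.conjTranspose_sub,
    Matrix.conjTranspose_mul, h0, hd', mul_smul_comm, sub_mul, mul_assoc,
    Matrix.mul_nonsing_inv _ ((Matrix.isUnit_iff_isUnit_det _).1 h), mul_one, smul_sub,
    friedrichsOdd, smul_neg, sub_eq_add_neg]

theorem kreinOdd_eq {a b : ℝ} {s : ℕ → Mat q} {n : ℕ} {z : ℂ} (hβ : (b : ℂ) - z ≠ 0)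
    (h0 : (s 0)ᴴ = s 0) (h : IsUnit (denKreinEven a (bs b s) n z)) :
    IsUnit (denKreinOdd a b s n z) ∧ kreinOdd a b s n z =
      ((b : ℂ) - z)⁻¹ • s 0 + ((b : ℂ) - z)⁻¹ • kreinEven a (bs b s) n z := by
  have hd : denKreinOdd a b s n z = ((b : ℂ) - z) • denKreinEven a (bs b s) n z := by
    rw [denKreinOdd, denKreinEven, P2_eq, smul_smul, mul_comm]
  refine ⟨hd ▸ h.smul (Units.mk0 _ hβ), ?_⟩
  have hQ : (Q2 a b s n (star z))ᴴ =
      -((Theta2 a (bs b s) n (star z))ᴴ + s 0 * denKreinEven a (bs b s) n z) := by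
    rw [Q2_eq, denKreinEven, P2_eq, Matrix.conjTranspose_neg, Matrix.conjTranspose_add,
      Matrix.conjTranspose_smul, Matrix.conjTranspose_mul, h0, mul_smul_comm]
    simp
  rw [kreinOdd, hd, smul_inv_of_isUnit h hβ, hQ, neg_mul, neg_neg, mul_smul_comm, add_mul,
    mul_assoc, Matrix.mul_nonsing_inv _ ((Matrix.isUnit_iff_isUnit_det _).1 h), mul_one, smul_add,
    kreinEven, add_comm]

/-! ### The four identities -/

theorem contFrac_cons_of_inv {c W : Mat q} {t : List (Mat q)} (hne : t ≠ [])
    (hd : ContFracDefined t) (hu : IsUnit (contFrac t)) (hv : (contFrac t)⁻¹ = W) :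
    ContFracDefined (c :: t) ∧ contFrac (c :: t) = c + W :=
  ⟨(contFracDefined_cons c hne).2 ⟨hu, hd⟩, by rw [contFrac_cons c hne, hv]⟩

section

variable {a b : ℝ} {s : ℕ → Mat q} {n : ℕ} {z : ℂ}

theorem mTerm_eq (c x : ℂ) (A : Mat q) : -(c * x) • A = x • (-c • A) := by
  rw [smul_smul, mul_neg, mul_comm]

theorem HausdorffPosDefEven.herm (h : HausdorffPosDefEven a b s n) : Herm s (2 * n + 1) :=
  herm_of_isHermitian h.1.isHermitian

theorem HausdorffPosDefEven.posOn_bs_sh (h : HausdorffPosDefEven a b s n) :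
    PosOn (bs b (sh a s)) n := by
  cases n with
  | zero => exact fun p hp h0 => absurd (degLT_zero hp) h0
  | succ n =>
    rw [bs_sh]
    exact posOn_of_posDef (by rw [← H2_eq]; exact h.2 n rfl)

theorem HausdorffPosDefEven.krein (hab : a < b) (h : HausdorffPosDefEven a b s n)
    (hz : z ∉ Complex.ofReal '' Set.Icc a b) :
    IsUnit (denKreinEven a s n z) ∧ ContFracDefined (termsKreinEven a s n z) ∧
      kreinEven a s n z = contFrac (termsKreinEven a s n z) := by
  have hs : PosOn s (n + 1) := posOn_of_posDef h.1
  have hb := h.posOn_bs_sh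
  -- (b-a)(t-a) = (b-t)(t-a) + (t-a)².
  have hsa : PosOn (sh a s) n :=
    posOn_of_bs_sh hab hb.nonnegOn hs.sh_sh.nonnegOn (Or.inl hb)
  obtain ⟨h1, h2, h3, h4⟩ := kreinEven_contFrac hab h.herm hs hsa hb.nonnegOn hz one_ne_zero
    (cM := fun j => -(z - (a : ℂ)) • M a s j) (cL := fun j => L a s j)
    (fun j => by rw [one_smul]) (fun j => by rw [inv_one, one_smul])
  obtain ⟨h5, h6⟩ := contFrac_cons_of_inv (c := 0) (by simp) h2 h3 h4
  refine ⟨h1, h5, ?_⟩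
  rw [inv_one, one_smul, zero_add] at h6
  exact h6.symm

theorem HausdorffPosDefEven.friedrichs (hab : a < b) (h : HausdorffPosDefEven a b s n)
    (hz : z ∉ Complex.ofReal '' Set.Icc a b) :
    IsUnit (denFriedrichsEven b s n z) ∧ ContFracDefined (termsFriedrichsEven a b s n z) ∧
      friedrichsEven b s n z = contFrac (termsFriedrichsEven a b s n z) := by
  have hβ := right_sub_ne_zero_of_notMem hab hz
  have h0 : (s 0)ᴴ = s 0 := h.herm 0 (by omega)
  cases n with
  | zero =>
    have hd : denFriedrichsEven b s 0 z = ((b : ℂ) - z) • (1 : Mat q) := by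
      simp [denFriedrichsEven, Gamma1]
    refine ⟨hd ▸ isUnit_one.smul (Units.mk0 _ hβ), trivial, ?_⟩
    rw [friedrichsEven, hd, smul_inv_of_isUnit isUnit_one hβ, Theta1, h0]
    simp [termsFriedrichsEven, mlList, contFrac]
  | succ n =>
    have hs : PosOn s (n + 2) := posOn_of_posDef h.1
    have hsa : PosOn (sh a (bs b s)) (n + 1) := by
      rw [← bs_sh]
      exact h.posOn_bs_sh
    have hbb : NonnegOn (bs b (bs b s)) (n + 1) := hs.nonnegOn.bs_bs
    -- (b-a)(b-t) = (b-t)² + (t-a)(b-t).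
    have hbs : PosOn (bs b s) (n + 1) := posOn_of_bs_sh hab hbb hsa.nonnegOn (Or.inr hsa)
    have hh : Herm (bs b s) (2 * n + 2) := Herm.bs (fun k hk => h.herm k (by omega)) b
    obtain ⟨h1, h2, h3, h4⟩ := friedrichsOdd_contFrac hh hbs hsa hbb hz hβ
      (cM := fun j => -((z - (a : ℂ)) * ((b : ℂ) - z)) • m a b s j)
      (cL := fun j => ((b : ℂ) - z)⁻¹ • l a b s j)
      (fun j => by rw [m_eq a b (hbs.mono (by omega)), mTerm_eq]) (fun j => by rw [l_eq a b h0])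
    obtain ⟨h5, h6⟩ := contFrac_cons_of_inv (c := ((b : ℂ) - z)⁻¹ • s 0)
      (by simp [altList_succ]) h2 h3 h4
    obtain ⟨h7, h8⟩ := friedrichsEven_succ hβ h0 h1
    exact ⟨h7, h5, h8.trans h6.symm⟩

theorem HausdorffPosDefOdd.posOn_bs (h : HausdorffPosDefOdd a b s n) :
    PosOn (bs b s) (n + 1) := posOn_of_posDef (by rw [← K1_eq]; exact h.1)

theorem HausdorffPosDefOdd.posOn_sh (h : HausdorffPosDefOdd a b s n) :
    PosOn (sh a s) (n + 1) := posOn_of_posDef (by rw [← K2_eq]; exact h.2)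

/-- Adding the two modified sequences recovers (b-a)s_k for k ≤ 2n; the last moment then comes from
s_{2n+1} - a s_{2n}. -/
theorem HausdorffPosDefOdd.herm (hab : a < b) (h : HausdorffPosDefOdd a b s n) :
    Herm s (2 * n + 2) := by
  have h1 : Herm (bs b s) (2 * n + 1) :=
    herm_of_isHermitian (by rw [← K1_eq]; exact h.1.isHermitian)
  have h2 : Herm (sh a s) (2 * n + 1) :=
    herm_of_isHermitian (by rw [← K2_eq]; exact h.2.isHermitian)
  have hba : (b : ℂ) - a ≠ 0 := sub_ne_zero.2 (by exact_mod_cast hab.ne')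
  have key : ∀ k < 2 * n + 1, (s k)ᴴ = s k := by
    intro k hk
    have hsum : s k = ((b : ℂ) - a)⁻¹ • (bs b s k + sh a s k) := by
      rw [bs, sh, sub_add_sub_cancel, ← sub_smul, smul_smul, inv_mul_cancel₀ hba, one_smul]
    rw [hsum, Matrix.conjTranspose_smul, Matrix.conjTranspose_add, h1 k hk, h2 k hk]
    simp
  intro k hk
  by_cases hk' : k < 2 * n + 1
  · exact key k hk'
  · obtain rfl : k = 2 * n + 1 := by omega
    have hsum : s (2 * n + 1) = sh a s (2 * n) + (a : ℂ) • s (2 * n) := by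
      rw [sh, sub_add_cancel]
    rw [hsum, Matrix.conjTranspose_add, h2 _ (by omega), Matrix.conjTranspose_smul,
      key _ (by omega)]
    simp

theorem HausdorffPosDefOdd.friedrichs (hab : a < b) (h : HausdorffPosDefOdd a b s n)
    (hz : z ∉ Complex.ofReal '' Set.Icc a b) :
    IsUnit (denFriedrichsOdd s n z) ∧ ContFracDefined (termsFriedrichsOdd a s n z) ∧
      friedrichsOdd s n z = contFrac (termsFriedrichsOdd a s n z) := by
  have hb := h.posOn_bs
  have hsa := h.posOn_sh
  have hs : PosOn s (n + 1) := posOn_of_bs_sh hab hb.nonnegOn hsa.nonnegOn (Or.inl hb)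
  obtain ⟨h1, h2, h3, h4⟩ := friedrichsOdd_contFrac (h.herm hab) hs hsa hb.nonnegOn hz one_ne_zero
    (cM := fun j => -(z - (a : ℂ)) • M a s j) (cL := fun j => L a s j)
    (fun j => by rw [one_smul]) (fun j => by rw [inv_one, one_smul])
  rw [altList_succ_last] at h2 h3 h4
  obtain ⟨h5, h6⟩ := contFrac_cons_of_inv (c := 0) (by simp) h2 h3 h4
  refine ⟨h1, h5, ?_⟩
  rw [inv_one, one_smul, zero_add] at h6
  exact h6.symm

theorem HausdorffPosDefOdd.krein (hab : a < b) (h : HausdorffPosDefOdd a b s n)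
    (hz : z ∉ Complex.ofReal '' Set.Icc a b) :
    IsUnit (denKreinOdd a b s n z) ∧ ContFracDefined (termsKreinOdd a b s n z) ∧
      kreinOdd a b s n z = contFrac (termsKreinOdd a b s n z) := by
  have hβ := right_sub_ne_zero_of_notMem hab hz
  have hh := h.herm hab
  have h0 : (s 0)ᴴ = s 0 := hh 0 (by omega)
  have hbs := h.posOn_bs
  have hbb : NonnegOn (bs b (sh a (bs b s))) n := by
    rw [← bs_sh]
    exact h.posOn_sh.nonnegOn.bs_bs
  -- (b-a)(t-a)(b-t) = (b-t)²(t-a) + (t-a)²(b-t).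
  have hsa : PosOn (sh a (bs b s)) n :=
    posOn_of_bs_sh hab hbb hbs.sh_sh.nonnegOn (Or.inr hbs.sh_sh)
  obtain ⟨h1, h2, h3, h4⟩ := kreinEven_contFrac hab (hh.bs b) hbs hsa hbb hz hβ
    (cM := fun j => -((z - (a : ℂ)) * ((b : ℂ) - z)) • m a b s j)
    (cL := fun j => ((b : ℂ) - z)⁻¹ • l a b s j)
    (fun j => by rw [m_eq a b (hbs.mono (by omega)), mTerm_eq]) (fun j => by rw [l_eq a b h0])
  obtain ⟨h5, h6⟩ := contFrac_cons_of_inv (c := ((b : ℂ) - z)⁻¹ • s 0) (by simp) h2 h3 h4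
  obtain ⟨h7, h8⟩ := kreinOdd_eq hβ h0 h1
  exact ⟨h7, h5, h8.trans h6.symm⟩

end

end THMM

end

theorem theorem6p2 (q n : ℕ) (a b : ℝ) (hab : a < b) (s : ℕ → Matrix (Fin q) (Fin q) ℂ) :
    (THMM.HausdorffPosDefEven a b s n →
      ∀ z : ℂ, z ∉ Complex.ofReal '' Set.Icc a b →
        (IsUnit (THMM.denFriedrichsEven b s n z) ∧
          THMM.ContFracDefined (THMM.termsFriedrichsEven a b s n z) ∧
          THMM.friedrichsEven b s n z = THMM.contFrac (THMM.termsFriedrichsEven a b s n z)) ∧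
        (IsUnit (THMM.denKreinEven a s n z) ∧
          THMM.ContFracDefined (THMM.termsKreinEven a s n z) ∧
          THMM.kreinEven a s n z = THMM.contFrac (THMM.termsKreinEven a s n z))) ∧
    (THMM.HausdorffPosDefOdd a b s n →
      ∀ z : ℂ, z ∉ Complex.ofReal '' Set.Icc a b →
        (IsUnit (THMM.denFriedrichsOdd s n z) ∧
          THMM.ContFracDefined (THMM.termsFriedrichsOdd a s n z) ∧
          THMM.friedrichsOdd s n z = THMM.contFrac (THMM.termsFriedrichsOdd a s n z)) ∧
        (IsUnit (THMM.denKreinOdd a b s n z) ∧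
          THMM.ContFracDefined (THMM.termsKreinOdd a b s n z) ∧
          THMM.kreinOdd a b s n z = THMM.contFrac (THMM.termsKreinOdd a b s n z))) :=
  ⟨fun h _ hz => ⟨h.friedrichs hab hz, h.krein hab hz⟩,
    fun h _ hz => ⟨h.friedrichs hab hz, h.krein hab hz⟩⟩
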